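/- **Setting.** Let $N,b\ge 1$, $F=\frac1N\sum_{i=1}^N F_i$ with $F_i:\mathbb{R}^d\to\mathbb{R}$ differentiable, $w_*$ a minimizer of $F$. Worker $i$ has a random oracle $g^i$ with $\mathbb{E}[g^i(w)]=\nabla F_i(w)$ and $\mathbb{E}\|g^i(w)\|^2<\infty$ for all $w$; at every iteration all oracles are drawn afresh, independently over iterations and workers. Assume, for constants $\mu,L>0$ and $\sigma_*$: $F$ is $\mu$-strongly convex; $\mathbb{E}\|g^i(w)-g^i(u)\|^2\le L\langle\nabla F_i(w)-\nabla F_i(u),w-u\rangle$ for all $i,w,u$; and $\mathbb{E}\|g^i(w_*)-\nabla F_i(w_*)\|^2\le\sigma_*^2/b$ for all $i$. Put $B^2=\frac1N\sum_i\|\nabla F_i(w_*)\|^2$. For $q\in(0,1]$, stochastic sparsification is $\mathcal C_q(x)=\frac1q(x_1B_1,\dots,x_dB_d)$ with $B_1,\dots,B_d$ i.i.d. Bernoulli of mean $q$. A variant $v$ is given by $q_{\rm up},q_{\rm dwn}\in(0,1]$ and a memory rate $\alpha$; set $\omega_{\rm up}=q_{\rm up}^{-1}-1$, $\omega_{\rm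 dwn}=q_{\rm dwn}^{-1}-1$ and assume $\alpha=0$ (no memory) or $\frac1{2(\omega_{\rm up}+1)}\le\alpha<\frac3{2(\omega_{\rm up}+1)}$. With full participation and step size $\gamma$, Artemis iterates, with fresh independent compressions, $$w_{k+1}=w_k-\gamma\,\mathcal C_{q_{\rm dwn}}\Big(\tfrac1N\sum_{i=1}^N(\widehat\Delta^i_k+h^i_k)\Big),\qquad h^i_{k+1}=h^i_k+\alpha\widehat\Delta^i_k,\qquad \widehat\Delta^i_k=\mathcal C_{q_{\rm up}}\big(g^i_{k+1}(w_k)-h^i_k\big),$$ from a deterministic $(w_0,(h_0^i)_i)$, with $h^i_0=0$ if $\alpha=0$ (then $h^i_k\equiv0$, and only distributions carried by $\{h=0\}$ are considered). Let $\Theta_k$ be the law of $w_k$. Call $\gamma>0$ *admissible* if: for $\alpha=0$, $\gamma\le\frac{N}{L(\omega_{\rm dwn}+1)(N+2(\omega_{\rm up}+1))}$; for $\alpha\ne0$, $$\gamma<\frac{N}{(\omega_{\rm dwn}+1)(N+4(\omega_{\rm up}+1)-2)L},\qquad \alpha<\frac{3N-\gamma L(\omega_{\rm dwn}+1)(3N+8(\omega_{\rm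 up}+1)-2)}{2(\omega_{\rm up}+1)\,(N-\gamma L(\omega_{\rm dwn}+1)(N+2))},\qquad 2\gamma\mu\le\alpha\,(3-2\alpha(\omega_{\rm up}+1)).$$ **1 (limit distribution).** For every admissible $\gamma$ the Markov chain $(w_k,(h^i_k)_i)$ has a unique stationary distribution $\Pi_{\gamma,v}$; let $\pi_{\gamma,v}$ be its $w$-marginal. There is $\tau>0$ such that for every starting point the constant $C_0=\int\big(\|w_0-w'\|^2+\tau^2\sum_i\|h^i_0-h'^i\|^2\big)\,d\Pi_{\gamma,v}(w',h')$ is finite and, for all $k\ge0$, $$\mathcal W_2^2(\Theta_k,\pi_{\gamma,v})\le(1-\gamma\mu)^k\,C_0;$$ the same bound holds for the squared $\mathcal W_2$-distance between the law of $(w_k,(\tau h^i_k)_i)$ and that of $(w,(\tau h^i)_i)$ under $\Pi_{\gamma,v}$. **2 (second moment and lower bound).** For every admissible $\gamma$ and every starting point, $\mathbb{E}\|w_k-w_*\|^2\to\mathbb{E}_{w\sim\pi_{\gamma,v}}\|w-w_*\|^2<\infty$ as $k\to\infty$. Let $$E=(\omega_{\rm dwn}+1)\Big((\omega_{\rm up}+1)\tfrac{\sigma_*^2}b+\omega_{\rm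 up}B^2\Big)\ \ (\alpha=0),\qquad E=\tfrac{\sigma_*^2}b\Big((2\omega_{\rm up}+1)(\omega_{\rm dwn}+1)+4\alpha^2C(\omega_{\rm up}+1)-2\alpha C\Big)\ \ (\alpha\ne0),$$ where $C$ is any constant with $C\ge\frac{(\omega_{\rm dwn}+1)\omega_{\rm up}}{\alpha(3-2\alpha(\omega_{\rm up}+1))}$ and $\alpha C\le\Lambda(\omega_{\rm dwn}+1)(\omega_{\rm up}+1)$. Assume that the noise level is tight: $\mathbb{E}\|g^i(w_*)-\nabla F_i(w_*)\|^2\ge\kappa\,\sigma_*^2/b$ for all $i$, where $\kappa>0$. Then there are $c>0$, depending only on $\mu,L,\kappa,\Lambda$ (not on $d,N,b,\sigma_*,B,\gamma,q_{\rm up},q_{\rm dwn},\alpha$ or the problem), and $\gamma_0>0$ (which may depend on everything but $\gamma$), such that every $\gamma\in(0,\gamma_0]$ is admissible and $$\mathbb{E}_{w\sim\pi_{\gamma,v}}\|w-w_*\|^2\ \ge\ c\,\frac{\gamma E}{\mu N}.$$ Thus the saturation level, of order $\gamma E/(\mu N)$, cannot be improved beyond a constant factor. -/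

import Mathlib

open MeasureTheory ProbabilityTheory Filter Topology
open scoped ENNReal

namespace Artemis

noncomputable section

/-- The parameter space `ℝ^d` with its Euclidean norm. -/
abbrev Param (d : ℕ) : Type := EuclideanSpace ℝ (Fin d)

/-- A state `(w, (h^i)_i)` of the algorithm: the model and the `N` memories. -/
abbrev State (d N : ℕ) : Type := Param d × (Fin N → Param d)

/-- The data of a distributed problem: local objectives `F_i`, and for each worker `i` a random
oracle `z ↦ g i w z` (with `z` drawn from `sampleLaw i`) for the stochastic gradient at `w`. -/
structure Problem (d N : ℕ) (Z : Type*) [MeasurableSpace Z] where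
  F : Fin N → Param d → ℝ
  sampleLaw : Fin N → Measure Z
  sampleLaw_prob : ∀ i, IsProbabilityMeasure (sampleLaw i)
  g : Fin N → Param d → Z → Param d
  g_meas : ∀ i, Measurable fun p : Param d × Z => g i p.1 p.2

attribute [instance] Problem.sampleLaw_prob

/-- Stochastic sparsification with keep probability `q`, for a given realization `B` of the
`{0,1}`-valued mask: `x ↦ (1/q) (x_1 B_1, …, x_d B_d)`. -/
def sparsify {d : ℕ} (q : ℝ) (B : Fin d → ℝ) (x : Param d) : Param d :=
  WithLp.toLp 2 fun j => q⁻¹ * (B j * x j)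

/-- The law of the mask: `d` independent Bernoulli variables of mean `q`. -/
def maskLaw (d : ℕ) (q : unitInterval) : Measure (Fin d → ℝ) :=
  Measure.pi fun _ => bernoulliMeasure (1 : ℝ) 0 q

instance (d : ℕ) (q : unitInterval) : IsProbabilityMeasure (maskLaw d q) := by
  unfold maskLaw; infer_instance

/-- A variant of the algorithm: keep probabilities of the uplink and of the downlink compression
(`1` means no compression), and the memory rate `α` (`0` means no memory). -/
structure Variant where
  qUp : unitInterval
  qDwn : unitInterval
  α : ℝ

namespace Variant

/-- The variance factor `1/q - 1` of the uplink compression. -/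
def ωUp (v : Variant) : ℝ := (v.qUp : ℝ)⁻¹ - 1

/-- The variance factor `1/q - 1` of the downlink compression. -/
def ωDwn (v : Variant) : ℝ := (v.qDwn : ℝ)⁻¹ - 1

/-- Standing conditions on a variant: positive keep probabilities, and either no memory or
`1/(2(ω_up+1)) ≤ α < 3/(2(ω_up+1))`. -/
structure Valid (v : Variant) : Prop where
  qUp_pos : 0 < (v.qUp : ℝ)
  qDwn_pos : 0 < (v.qDwn : ℝ)
  α_range : v.α = 0 ∨ (1 / (2 * (v.ωUp + 1)) ≤ v.α ∧ v.α < 3 / (2 * (v.ωUp + 1)))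

/-- The conditions on the step size `γ` (and, jointly, on the memory rate) for `N` workers, strong
convexity constant `μ` and cocoercivity constant `L`. -/
structure StepSize (v : Variant) (N : ℕ) (μ L γ : ℝ) : Prop where
  pos : 0 < γ
  noMemory : v.α = 0 →
    γ ≤ N / (L * (v.ωDwn + 1) * (N + 2 * (v.ωUp + 1)))
  memory : v.α ≠ 0 →
    γ < N / ((v.ωDwn + 1) * (N + 4 * (v.ωUp + 1) - 2) * L) ∧
    v.α < (3 * N - γ * L * (v.ωDwn + 1) * (3 * N + 8 * (v.ωUp + 1) - 2)) /
      (2 * (v.ωUp + 1) * (N - γ * L * (v.ωDwn + 1) * (N + 2))) ∧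
    2 * (γ * μ) ≤ v.α * (3 - 2 * v.α * (v.ωUp + 1))

/-- The smallest admissible value of the Lyapunov constant `C` for the variants with memory. -/
def minC (v : Variant) : ℝ :=
  ((v.ωDwn + 1) * v.ωUp) / (v.α * (3 - 2 * v.α * (v.ωUp + 1)))

/-- The constant `E` of the saturation level `2γE/(μN)`. Here `s` is the noise level `σ_*²/b` at
the optimum, `B2` is the heterogeneity `B²`, and `C` is the Lyapunov constant. -/
def satConst (v : Variant) (s B2 C : ℝ) : ℝ :=
  if v.α = 0 then (v.ωDwn + 1) * ((v.ωUp + 1) * s + v.ωUp * B2)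
  else s * ((2 * v.ωUp + 1) * (v.ωDwn + 1) + 4 * v.α ^ 2 * C * (v.ωUp + 1) - 2 * v.α * C)

end Variant

/-- The noise of one iteration: the samples of the workers, their uplink masks, and the downlink
mask. -/
abbrev Noise (d N : ℕ) (Z : Type*) : Type _ :=
  (Fin N → Z) × (Fin N → Fin d → ℝ) × (Fin d → ℝ)

namespace Problem

variable {d N : ℕ} {Z : Type*} [MeasurableSpace Z]

/-- The global objective `F = (1/N) ∑ F_i`. -/
def objective (P : Problem d N Z) (w : Param d) : ℝ := (N : ℝ)⁻¹ * ∑ i, P.F i w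

/-- All the sources of noise of one iteration are independent. -/
def noiseLaw (P : Problem d N Z) (v : Variant) : Measure (Noise d N Z) :=
  (Measure.pi P.sampleLaw).prod
    ((Measure.pi fun _ : Fin N => maskLaw d v.qUp).prod (maskLaw d v.qDwn))

instance (P : Problem d N Z) (v : Variant) : IsProbabilityMeasure (P.noiseLaw v) := by
  unfold noiseLaw; infer_instance

/-- The compressed difference sent by worker `i`. -/
def compressedDiff (P : Problem d N Z) (v : Variant) (x : State d N) (ξ : Noise d N Z)
    (i : Fin N) : Param d :=
  sparsify v.qUp (ξ.2.1 i) (P.g i x.1 (ξ.1 i) - x.2 i)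

/-- One iteration of Artemis with full participation. -/
def step (P : Problem d N Z) (v : Variant) (γ : ℝ) (x : State d N) (ξ : Noise d N Z) :
    State d N :=
  (x.1 - γ • sparsify v.qDwn ξ.2.2
      ((N : ℝ)⁻¹ • ∑ i, (P.compressedDiff v x ξ i + x.2 i)),
    fun i => x.2 i + v.α • P.compressedDiff v x ξ i)

lemma measurable_sparsify (q : ℝ) :
    Measurable fun p : (Fin d → ℝ) × Param d => sparsify q p.1 p.2 := by
  unfold sparsify
  refine (WithLp.measurable_toLp 2 _).comp ?_
  fun_prop

lemma measurable_compressedDiff (P : Problem d N Z) (v : Variant) (i : Fin N) :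
    Measurable fun p : State d N × Noise d N Z => P.compressedDiff v p.1 p.2 i := by
  have hg : Measurable fun p : State d N × Noise d N Z => P.g i p.1.1 (p.2.1 i) :=
    (P.g_meas i).comp (f := fun p : State d N × Noise d N Z => (p.1.1, p.2.1 i)) (by fun_prop)
  exact (measurable_sparsify (d := d) v.qUp).comp
    (f := fun p : State d N × Noise d N Z => (p.2.2.1 i, P.g i p.1.1 (p.2.1 i) - p.1.2 i))
    (by fun_prop)

lemma measurable_step (P : Problem d N Z) (v : Variant) (γ : ℝ) :
    Measurable fun p : State d N × Noise d N Z => P.step v γ p.1 p.2 := by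
  have hc := fun i => P.measurable_compressedDiff v i
  have hs : Measurable fun p : State d N × Noise d N Z =>
      sparsify v.qDwn p.2.2.2
        ((N : ℝ)⁻¹ • ∑ i, (P.compressedDiff v p.1 p.2 i + p.1.2 i)) :=
    (measurable_sparsify (d := d) v.qDwn).comp
      (f := fun p : State d N × Noise d N Z => (p.2.2.2,
        (N : ℝ)⁻¹ • ∑ i, (P.compressedDiff v p.1 p.2 i + p.1.2 i))) (by fun_prop)
  unfold step
  fun_prop

/-- The Markov kernel of the iterates: from `x`, the law of `step x ξ` for a fresh noise `ξ`. -/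
def kernel (P : Problem d N Z) (v : Variant) (γ : ℝ) : Kernel (State d N) (State d N) where
  toFun x := (P.noiseLaw v).map (P.step v γ x)
  measurable' := by
    have h := ((Kernel.id ×ₖ Kernel.const (State d N) (P.noiseLaw v)).map
      fun p : State d N × Noise d N Z => P.step v γ p.1 p.2).measurable
    convert h using 2 with x
    rw [Kernel.map_apply _ (P.measurable_step v γ), Kernel.prod_apply, Kernel.id_apply,
      Kernel.const_apply, Measure.dirac_prod,
      Measure.map_map (P.measurable_step v γ) (by fun_prop)]
    rfl

/-- The law `Θ_k` of `w_k` when the chain is started at `x₀ = (w_0, (h_0^i)_i)`. -/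
def modelLaw (P : Problem d N Z) (v : Variant) (γ : ℝ) (x₀ : State d N) (k : ℕ) :
    Measure (Param d) :=
  ((P.kernel v γ ^ k) x₀).map Prod.fst

/-- Without memory the chain lives on `{h = 0}`. -/
def Allowed (v : Variant) (x : State d N) : Prop := v.α = 0 → ∀ i, x.2 i = 0

/-- `ρ` is a stationary distribution of the chain. -/
structure IsStationary (P : Problem d N Z) (v : Variant) (γ : ℝ) (ρ : Measure (State d N)) :
    Prop where
  prob : IsProbabilityMeasure ρ
  invariant : (P.kernel v γ).Invariant ρ
  allowed : ∀ᵐ x ∂ρ, Allowed v x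

/-- The assumptions on the problem. Conditional statements given the past become statements about
one draw, since the samples of an iteration are fresh. -/
structure Assumptions (P : Problem d N Z) (μ L σ : ℝ) (b : ℕ) (wopt : Param d) : Prop where
  differentiable : ∀ i, Differentiable ℝ (P.F i)
  /-- square-integrable stochastic gradients -/
  memLp : ∀ i w, MemLp (P.g i w) 2 (P.sampleLaw i)
  unbiased : ∀ i w, ∫ z, P.g i w z ∂(P.sampleLaw i) = gradient (P.F i) w
  /-- strong convexity of the global objective -/
  strongConvex : ∀ w u, P.objective w + inner ℝ (u - w) (gradient P.objective w)
    + μ / 2 * ‖u - w‖ ^ 2 ≤ P.objective u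
  /-- cocoercivity in quadratic mean -/
  cocoercive : ∀ i w u, ∫ z, ‖P.g i w z - P.g i u z‖ ^ 2 ∂(P.sampleLaw i)
    ≤ L * inner ℝ (gradient (P.F i) w - gradient (P.F i) u) (w - u)
  optimal : ∀ w, P.objective wopt ≤ P.objective w
  /-- bounded noise at the optimum, for mini-batches of size `b` -/
  noise : ∀ i, ∫ z, ‖P.g i wopt z - gradient (P.F i) wopt‖ ^ 2 ∂(P.sampleLaw i) ≤ σ ^ 2 / b

/-- The heterogeneity `B² = (1/N) ∑ ‖∇F_i(w_*)‖²`. -/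
def heterogeneity (P : Problem d N Z) (wopt : Param d) : ℝ :=
  (N : ℝ)⁻¹ * ∑ i, ‖gradient (P.F i) wopt‖ ^ 2

end Problem

/-- The couplings of two measures. -/
def couplings {X : Type*} [MeasurableSpace X] (ν₁ ν₂ : Measure X) : Set (Measure (X × X)) :=
  {ξ | ξ.map Prod.fst = ν₁ ∧ ξ.map Prod.snd = ν₂}

/-- The optimal transport cost between two measures for the cost function `c`. -/
def transportCost {X : Type*} [MeasurableSpace X] (c : X → X → ℝ≥0∞) (ν₁ ν₂ : Measure X) : ℝ≥0∞ :=
  ⨅ ξ ∈ couplings ν₁ ν₂, ∫⁻ p, c p.1 p.2 ∂ξ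

/-- Squared Wasserstein distance of order 2 on the parameter space. -/
def w2Sq {d : ℕ} (ν₁ ν₂ : Measure (Param d)) : ℝ≥0∞ :=
  transportCost (fun x y => ENNReal.ofReal (‖x - y‖ ^ 2)) ν₁ ν₂

/-- Squared Euclidean distance between `(w, (τ h^i)_i)` and `(w', (τ h'^i)_i)`. -/
def stateSqDist {d N : ℕ} (τ : ℝ) (x y : State d N) : ℝ≥0∞ :=
  ENNReal.ofReal (‖x.1 - y.1‖ ^ 2 + τ ^ 2 * ∑ i, ‖x.2 i - y.2 i‖ ^ 2)

/-- Squared Wasserstein distance of order 2 on the state space, memories being scaled by `τ`. -/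
def stateW2Sq {d N : ℕ} (τ : ℝ) (ν₁ ν₂ : Measure (State d N)) : ℝ≥0∞ :=
  transportCost (stateSqDist τ) ν₁ ν₂

end

end Artemis

set_option linter.unusedSectionVars false

namespace Artemis

/-! ### Random iterations -/

section RandomIteration

variable {E Ω : Type*} [MeasurableSpace E] [MeasurableSpace Ω]

/-! Everything rests on the synchronous coupling: run two copies of the chain with the same samples
and the same masks. For a fixed mask sparsification is linear, so the difference of the two copies
obeys a recursion of the same form, driven by the differences of the stochastic gradients
(`step_fst_sub`, `step_snd_sub`). Its second moment is computed exactly, coordinate by coordinate,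
in `integral_sqDist_step`.

Strong monotonicity and cocoercivity then yield a contraction by `1 - γμ` of `‖w - w'‖² + τ² ∑ ‖h^i
- h'^i‖²` (`contraction_noMemory`, `exists_contraction_memory`). The descent term `2γX`, where `X`
pairs the difference of the averaged gradients with `w - w'`, is split in two: one half gives the
rate through `X ≥ μ‖w - w'‖²`, the other absorbs the terms of order `γ²`. With memory, `τ` must be
tuned so that the cross terms between gradients and memories cancel; this is `exists_memory_weight`.

The consequences of such a contraction are proved for an abstract random iteration
(`IsContractive`). The backward iterates form a Cauchy sequence in `L²`, and the law of their limit
is stationary (`exists_invariant`). Coupling two stationary laws gives uniqueness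
(`invariant_unique`). Coupling a trajectory with a stationary one gives the Wasserstein bounds
(`exists_coupling_le`) and the convergence of second moments (`tendsto_integral_sq`).

For the lower bound, the one-step error is decomposed exactly into bias and variance. Since the
noise at `w` controls the noise at the optimum up to a multiple of `X`, one step maps the squared
error to at least `(1 - 3γL)‖w - w_*‖²` plus a variance term of order `γ²`
(`integral_step_sub_wopt_ge`). Stationarity equates the mean squared error before and after the
step, hence `3γL` times this error is at least the variance term (`stationary_moment_ge`). Comparing
that term with `E` is elementary (`satConst_le`). -/

lemma measurable_section {f : E → Ω → E} (hf : Measurable fun p : E × Ω => f p.1 p.2) (x : E) :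
    Measurable (f x) :=
  hf.comp (measurable_prodMk_left (x := x))

/-- The Markov kernel `x ↦ law of f x ξ` of the random iteration `x ↦ f x ξ`. -/
noncomputable def iterKernel (P : Measure Ω) [SFinite P] (f : E → Ω → E)
    (hf : Measurable fun p : E × Ω => f p.1 p.2) : Kernel E E where
  toFun x := P.map (f x)
  measurable' := by
    refine Measure.measurable_of_measurable_coe _ fun s hs => ?_
    have : ∀ x, P.map (f x) s = P (Prod.mk x ⁻¹' ((fun p : E × Ω => f p.1 p.2) ⁻¹' s)) := by
      intro x
      rw [Measure.map_apply (measurable_section hf x) hs]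
      rfl
    simp_rw [this]
    exact measurable_measure_prodMk_left (hf hs)

/-- Two copies of a random iteration driven by the same noise. -/
def coupledMap (f : E → Ω → E) (x : E × E) (ξ : Ω) : E × E := (f x.1 ξ, f x.2 ξ)

lemma measurable_coupledMap {f : E → Ω → E} (hf : Measurable fun p : E × Ω => f p.1 p.2) :
    Measurable fun p : (E × E) × Ω => coupledMap f p.1 p.2 :=
  (hf.comp (f := fun p : (E × E) × Ω => (p.1.1, p.2)) (by fun_prop)).prodMk
    (hf.comp (f := fun p : (E × E) × Ω => (p.1.2, p.2)) (by fun_prop))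

variable {P : Measure Ω} [IsProbabilityMeasure P] {f : E → Ω → E}
  {hf : Measurable fun p : E × Ω => f p.1 p.2}

lemma iterKernel_apply (x : E) : iterKernel P f hf x = P.map (f x) := rfl

instance : IsMarkovKernel (iterKernel P f hf) where
  isProbabilityMeasure x :=
    Measure.isProbabilityMeasure_map (measurable_section hf x).aemeasurable

lemma isMarkovKernel_pow (K : Kernel E E) [IsMarkovKernel K] (k : ℕ) : IsMarkovKernel (K ^ k) := by
  induction k with
  | zero => exact inferInstanceAs (IsMarkovKernel (Kernel.id : Kernel E E))
  | succ k ih => rw [pow_succ]; exact inferInstanceAs (IsMarkovKernel ((K ^ k) ∘ₖ K))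

lemma lintegral_iterKernel {φ : E → ℝ≥0∞} (hφ : Measurable φ) (x : E) :
    ∫⁻ y, φ y ∂(iterKernel P f hf x) = ∫⁻ ξ, φ (f x ξ) ∂P :=
  lintegral_map hφ (measurable_section hf x)

lemma comp_iterKernel (m : Measure E) [SFinite m] :
    (iterKernel P f hf) ∘ₘ m = (m.prod P).map fun p => f p.1 p.2 := by
  ext s hs
  rw [Measure.bind_apply hs (Kernel.aemeasurable _), Measure.map_apply hf hs,
    Measure.prod_apply (hf hs)]
  refine lintegral_congr fun x => ?_
  rw [iterKernel_apply, Measure.map_apply (measurable_section hf x) hs]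
  rfl

/-- Semiconjugacy passes to powers one step at a time. With `φ` a coordinate projection, it shows
that each component of the coupled chain is a copy of the original chain. -/
lemma map_pow_comp_of_semiconj {E' : Type*} [MeasurableSpace E'] {K : Kernel E E}
    {K' : Kernel E' E'} {φ : E → E'} (hφ : Measurable φ) (h : ∀ x, (K x).map φ = K' (φ x))
    (k : ℕ) (m : Measure E) : ((K ^ k) ∘ₘ m).map φ = (K' ^ k) ∘ₘ (m.map φ) := by
  induction k generalizing m with
  | zero =>
    rw [pow_zero, pow_zero]
    exact (congrArg (Measure.map φ) Measure.id_comp).trans Measure.id_comp.symm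
  | succ k ih =>
    have h1 : (K ∘ₘ m).map φ = K' ∘ₘ (m.map φ) := by
      rw [Measure.map_comp _ _ hφ]
      ext s hs
      rw [Measure.bind_apply hs (Kernel.aemeasurable _),
        Measure.bind_apply hs (Kernel.aemeasurable _),
        lintegral_map (K'.measurable_coe hs) hφ]
      refine lintegral_congr fun x => ?_
      rw [Kernel.map_apply _ hφ, h]
    have e1 : (K ^ (k + 1)) ∘ₘ m = (K ^ k) ∘ₘ (K ∘ₘ m) := by
      rw [pow_succ, Measure.comp_assoc]; rfl
    have e2 : (K' ^ (k + 1)) ∘ₘ (m.map φ) = (K' ^ k) ∘ₘ (K' ∘ₘ (m.map φ)) := by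
      rw [pow_succ, Measure.comp_assoc]; rfl
    rw [e1, e2, ih, h1]

lemma pow_comp_of_invariant {K : Kernel E E} {m : Measure E} (h : K.Invariant m) (k : ℕ) :
    (K ^ k) ∘ₘ m = m := by
  induction k with
  | zero => rw [pow_zero]; exact Measure.id_comp
  | succ k ih =>
    have e1 : (K ^ (k + 1)) ∘ₘ m = (K ^ k) ∘ₘ (K ∘ₘ m) := by
      rw [pow_succ, Measure.comp_assoc]; rfl
    rw [e1, h.def, ih]

lemma comp_dirac_eq {E' : Type*} [MeasurableSpace E'] (K : Kernel E E') (x : E) :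
    K ∘ₘ (Measure.dirac x) = K x :=
  Measure.dirac_bind K.measurable x

/-- The synchronous coupling of two copies of the chain. -/
noncomputable abbrev coupledKernel (P : Measure Ω) [SFinite P] (f : E → Ω → E)
    (hf : Measurable fun p : E × Ω => f p.1 p.2) : Kernel (E × E) (E × E) :=
  iterKernel P (coupledMap f) (measurable_coupledMap hf)

lemma map_fst_coupledKernel_pow (k : ℕ) (m : Measure (E × E)) :
    ((coupledKernel P f hf ^ k) ∘ₘ m).map Prod.fst
      = (iterKernel P f hf ^ k) ∘ₘ (m.map Prod.fst) := by
  refine map_pow_comp_of_semiconj measurable_fst (fun x => ?_) k m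
  rw [iterKernel_apply, Measure.map_map measurable_fst
    (measurable_section (measurable_coupledMap hf) x)]
  rfl

lemma map_snd_coupledKernel_pow (k : ℕ) (m : Measure (E × E)) :
    ((coupledKernel P f hf ^ k) ∘ₘ m).map Prod.snd
      = (iterKernel P f hf ^ k) ∘ₘ (m.map Prod.snd) := by
  refine map_pow_comp_of_semiconj measurable_snd (fun x => ?_) k m
  rw [iterKernel_apply, Measure.map_map measurable_snd
    (measurable_section (measurable_coupledMap hf) x)]
  rfl

variable {c : E × E → ℝ≥0∞} {A : Set E} {r : ℝ≥0∞}

/-- Conditioning on the first step reduces `k + 1` steps to `k` steps from a random pair. That pair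
stays in `A`, so the induction hypothesis applies under the integral. -/
lemma lintegral_coupledKernel_pow_le (hc : Measurable c)
    (hfA : ∀ x ∈ A, ∀ ξ, f x ξ ∈ A)
    (hcontr : ∀ x ∈ A, ∀ y ∈ A, ∫⁻ ξ, c (f x ξ, f y ξ) ∂P ≤ r * c (x, y))
    (k : ℕ) : ∀ x ∈ A, ∀ y ∈ A,
      ∫⁻ p, c p ∂((coupledKernel P f hf ^ k) (x, y)) ≤ r ^ k * c (x, y) := by
  induction k with
  | zero =>
    intro x _ y _
    rw [pow_zero, pow_zero, one_mul]
    exact (lintegral_dirac' _ hc).le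
  | succ k ih =>
    intro x hx y hy
    have e1 : (coupledKernel P f hf ^ (k + 1)) (x, y)
      = ((coupledKernel P f hf ^ k) ∘ₖ (coupledKernel P f hf)) (x, y) := by
      rw [pow_succ]; rfl
    rw [e1, Kernel.lintegral_comp _ _ _ hc, lintegral_iterKernel (by fun_prop)]
    calc ∫⁻ ξ, ∫⁻ p, c p ∂((coupledKernel P f hf ^ k) (coupledMap f (x, y) ξ)) ∂P
        ≤ ∫⁻ ξ, r ^ k * c (f x ξ, f y ξ) ∂P :=
          lintegral_mono fun ξ => ih _ (hfA x hx ξ) _ (hfA y hy ξ)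
      _ = r ^ k * ∫⁻ ξ, c (f x ξ, f y ξ) ∂P := by
          refine lintegral_const_mul _ (hc.comp ?_)
          exact measurable_section (measurable_coupledMap hf) (x, y)
      _ ≤ r ^ k * (r * c (x, y)) := by gcongr; exact hcontr x hx y hy
      _ = _ := by rw [pow_succ, mul_assoc]

/-- Contraction of the synchronous coupling, from an arbitrary initial coupling. -/
lemma lintegral_coupledKernel_pow_comp_le (hc : Measurable c)
    (hfA : ∀ x ∈ A, ∀ ξ, f x ξ ∈ A)
    (hcontr : ∀ x ∈ A, ∀ y ∈ A, ∫⁻ ξ, c (f x ξ, f y ξ) ∂P ≤ r * c (x, y))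
    (k : ℕ) {m : Measure (E × E)} (hm : ∀ᵐ p ∂m, p.1 ∈ A ∧ p.2 ∈ A) :
    ∫⁻ p, c p ∂((coupledKernel P f hf ^ k) ∘ₘ m) ≤ r ^ k * ∫⁻ p, c p ∂m := by
  rw [Measure.lintegral_bind (Kernel.aemeasurable _) hc.aemeasurable, ← lintegral_const_mul _ hc]
  refine lintegral_mono_ae ?_
  filter_upwards [hm] with p hp
  exact lintegral_coupledKernel_pow_le hc hfA hcontr k p.1 hp.1 p.2 hp.2

end RandomIteration

/-! ### Equality of laws from couplings close to the diagonal -/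

/-- Two probability measures are equal if they admit couplings that are concentrated
arbitrarily close to the diagonal. -/
lemma measure_le_of_couplings {E : Type*} [PseudoEMetricSpace E] [MeasurableSpace E]
    [BorelSpace E] [SecondCountableTopology E] {ν₁ ν₂ : Measure E} [IsFiniteMeasure ν₂]
    (m : ℕ → Measure (E × E)) (h1 : ∀ k, (m k).map Prod.fst = ν₁)
    (h2 : ∀ k, (m k).map Prod.snd = ν₂)
    (hlim : ∀ δ : ℝ, 0 < δ →
      Tendsto (fun k => m k {p | ENNReal.ofReal δ < edist p.1 p.2}) atTop (𝓝 0))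
    {F : Set E} (hF : IsClosed F) : ν₁ F ≤ ν₂ F := by
  have key : ∀ δ : ℝ, 0 < δ → ν₁ F ≤ ν₂ (Metric.cthickening δ F) := by
    intro δ hδ
    -- If the first coordinate lies in `F`, either the two coordinates are more than `δ` apart or
    -- the second one lies in the `δ`-thickening.
    have hk : ∀ k, ν₁ F ≤ ν₂ (Metric.cthickening δ F)
        + m k {p | ENNReal.ofReal δ < edist p.1 p.2} := by
      intro k
      rw [← h1 k, ← h2 k, Measure.map_apply measurable_fst hF.measurableSet,
        Measure.map_apply measurable_snd Metric.isClosed_cthickening.measurableSet]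
      refine (measure_mono fun p hp => ?_).trans (measure_union_le _ _)
      by_cases h : ENNReal.ofReal δ < edist p.1 p.2
      · exact Or.inr h
      · left
        simp only [Set.mem_preimage] at hp ⊢
        rw [Metric.mem_cthickening_iff]
        push Not at h
        refine (Metric.infEDist_le_edist_of_mem hp).trans ?_
        rwa [edist_comm]
    have := (tendsto_const_nhds (x := ν₂ (Metric.cthickening δ F))).add (hlim δ hδ)
    rw [add_zero] at this
    exact ge_of_tendsto' this hk
  have h := tendsto_measure_cthickening_of_isClosed (μ := ν₂) (s := F)
    ⟨1, one_pos, measure_ne_top _ _⟩ hF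
  refine ge_of_tendsto (h.mono_left (nhdsWithin_le_nhds (s := Set.Ioi 0))) ?_
  filter_upwards [self_mem_nhdsWithin] with δ hδ using key δ hδ

/-- Closed sets form a π-system generating the Borel sets, and swapping the coordinates of the
couplings gives the reverse inequality on them. -/
lemma measure_eq_of_couplings {E : Type*} [PseudoEMetricSpace E] [MeasurableSpace E]
    [BorelSpace E] [SecondCountableTopology E] {ν₁ ν₂ : Measure E} [IsProbabilityMeasure ν₁]
    [IsProbabilityMeasure ν₂]
    (m : ℕ → Measure (E × E)) (h1 : ∀ k, (m k).map Prod.fst = ν₁)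
    (h2 : ∀ k, (m k).map Prod.snd = ν₂)
    (hlim : ∀ δ : ℝ, 0 < δ →
      Tendsto (fun k => m k {p | ENNReal.ofReal δ < edist p.1 p.2}) atTop (𝓝 0)) :
    ν₁ = ν₂ := by
  refine ext_of_generate_finite _ (BorelSpace.measurable_eq.trans borel_eq_generateFrom_isClosed)
    isPiSystem_isClosed (fun F hF => ?_) (by simp)
  refine le_antisymm (measure_le_of_couplings m h1 h2 hlim hF)
    (measure_le_of_couplings (fun k => (m k).map Prod.swap) ?_ ?_ ?_ hF)
  · intro k; rw [Measure.map_map measurable_fst measurable_swap]; exact h2 k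
  · intro k; rw [Measure.map_map measurable_snd measurable_swap]; exact h1 k
  · intro δ hδ
    refine (hlim δ hδ).congr fun k => ?_
    rw [Measure.map_apply measurable_swap]
    · congr 1; ext p; simp [edist_comm]
    · exact measurableSet_lt measurable_const (by fun_prop)

/-! ### Stationary laws of random iterations that contract in mean -/

section Contractive

variable {E Ω : Type*} [NormedAddCommGroup E] [MeasurableSpace E] [BorelSpace E]
  [SecondCountableTopology E] [MeasurableSpace Ω]

/-- The random iteration `x ↦ f x ξ` contracts in mean, on the closed invariant set `A`, a cost
that is comparable with the squared distance. -/
structure IsContractive (P : Measure Ω) (f : E → Ω → E) (c : E × E → ℝ≥0∞) (A : Set E)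
    (r K K' : ℝ≥0∞) : Prop where
  measurable_map : Measurable fun p : E × Ω => f p.1 p.2
  measurable_cost : Measurable c
  isClosed : IsClosed A
  mapsTo : ∀ x ∈ A, ∀ ξ, f x ξ ∈ A
  contract : ∀ x ∈ A, ∀ y ∈ A, ∫⁻ ξ, c (f x ξ, f y ξ) ∂P ≤ r * c (x, y)
  rate_lt_one : r < 1
  lower_ne_top : K ≠ ∞
  upper_ne_top : K' ≠ ∞
  sq_le_cost : ∀ x y, ‖x - y‖ₑ ^ 2 ≤ K * c (x, y)
  cost_le_sq : ∀ x y, c (x, y) ≤ K' * ‖x - y‖ₑ ^ 2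
  start : ∀ x ∈ A, ∫⁻ ξ, c (x, f x ξ) ∂P ≠ ∞

namespace IsContractive

variable {P : Measure Ω} [IsProbabilityMeasure P] {f : E → Ω → E} {c : E × E → ℝ≥0∞}
  {A : Set E} {r K K' : ℝ≥0∞}

lemma eLpNorm_two_sq {α : Type*} [MeasurableSpace α] (μ : Measure α) (g : α → E) :
    eLpNorm g 2 μ ^ 2 = ∫⁻ x, ‖g x‖ₑ ^ 2 ∂μ := by
  rw [eLpNorm_eq_lintegral_rpow_enorm_toReal (by norm_num) (by norm_num),
    ← ENNReal.rpow_natCast, ← ENNReal.rpow_mul]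
  simp

lemma tendsto_pow_mul (h : IsContractive P f c A r K K') {a : ℝ≥0∞} (ha : a ≠ ∞) :
    Tendsto (fun k : ℕ => r ^ k * a) atTop (𝓝 0) := by
  have := ENNReal.Tendsto.mul_const (ENNReal.tendsto_pow_atTop_nhds_zero_of_lt_one h.rate_lt_one)
    (Or.inr ha)
  simpa using this

lemma cost_ne_top (h : IsContractive P f c A r K K') (x y : E) : c (x, y) ≠ ∞ :=
  ((h.cost_le_sq x y).trans_lt
    (ENNReal.mul_lt_top h.upper_ne_top.lt_top (by finiteness))).ne

/-- An invariant probability measure carried by `A` is unique. -/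
theorem invariant_unique (h : IsContractive P f c A r K K') {ν₁ ν₂ : Measure E}
    [IsProbabilityMeasure ν₁] [IsProbabilityMeasure ν₂]
    (h1 : (iterKernel P f h.measurable_map).Invariant ν₁)
    (h2 : (iterKernel P f h.measurable_map).Invariant ν₂)
    (hA1 : ∀ᵐ x ∂ν₁, x ∈ A) (hA2 : ∀ᵐ x ∂ν₂, x ∈ A) : ν₁ = ν₂ := by
  let R : ℕ → Kernel (E × E) (E × E) := fun k => coupledKernel P f h.measurable_map ^ k
  have hQ : ∀ k, IsMarkovKernel (R k) := fun k => isMarkovKernel_pow _ k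
  have hA : ∀ᵐ p ∂(ν₁.prod ν₂), p.1 ∈ A ∧ p.2 ∈ A := by
    refine Filter.Eventually.and ?_ ?_
    · exact Measure.quasiMeasurePreserving_fst.ae hA1
    · exact Measure.quasiMeasurePreserving_snd.ae hA2
  refine measure_eq_of_couplings (fun k => (R k) ∘ₘ (ν₁.prod ν₂)) ?_ ?_ ?_
  · intro k
    simp only [R]; rw [map_fst_coupledKernel_pow, Measure.map_fst_prod, measure_univ, one_smul,
      pow_comp_of_invariant h1]
  · intro k
    simp only [R]; rw [map_snd_coupledKernel_pow, Measure.map_snd_prod, measure_univ, one_smul,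
      pow_comp_of_invariant h2]
  · intro δ hδ
    set S : Set (E × E) := {p | ENNReal.ofReal δ < edist p.1 p.2}
    have hS : MeasurableSet S := measurableSet_lt measurable_const (by fun_prop)
    have hb : ∀ k, ((R k) ∘ₘ (ν₁.prod ν₂)) S = ∫⁻ p, (R k) p S ∂(ν₁.prod ν₂) :=
      fun k => Measure.bind_apply hS (Kernel.aemeasurable _)
    simp_rw [hb]
    rw [← lintegral_zero (μ := ν₁.prod ν₂)]
    -- The two laws are not assumed to have second moments, so the cost may fail to be integrable
    -- for the product coupling. The contraction is therefore used, through Markov's inequality,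
    -- from each fixed starting pair, and the resulting probabilities are integrated by dominated
    -- convergence with bound `1`.
    refine tendsto_lintegral_of_dominated_convergence (fun _ => 1)
      (fun k => Kernel.measurable_coe _ hS) (fun k => ae_of_all _ fun p => prob_le_one)
      (by simp) ?_
    filter_upwards [hA] with p hp
    have hδ' : ENNReal.ofReal δ ^ 2 ≠ 0 := by positivity
    have hle : ∀ k, (R k) p S ≤ r ^ k * (K * c p / ENNReal.ofReal δ ^ 2) := by
      intro k
      have e1 : (R k) p S ≤ (∫⁻ q, K * c q ∂((R k) p)) / ENNReal.ofReal δ ^ 2 := by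
        refine (measure_mono fun q hq => ?_).trans (meas_ge_le_lintegral_div
          ((h.measurable_cost.const_mul K).aemeasurable) hδ' (by finiteness))
        have hq' : ENNReal.ofReal δ ≤ ‖q.1 - q.2‖ₑ := by
          rw [← edist_eq_enorm_sub]; exact le_of_lt hq
        exact (pow_le_pow_left' hq' 2).trans (h.sq_le_cost q.1 q.2)
      refine e1.trans ?_
      rw [lintegral_const_mul _ h.measurable_cost]
      have := lintegral_coupledKernel_pow_le (P := P) (hf := h.measurable_map) h.measurable_cost
        h.mapsTo h.contract k p.1 hp.1 p.2 hp.2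
      calc K * (∫⁻ q, c q ∂((R k) p)) / ENNReal.ofReal δ ^ 2
          ≤ K * (r ^ k * c p) / ENNReal.ofReal δ ^ 2 := by gcongr
        _ = _ := by rw [mul_left_comm, mul_div_assoc]
    refine tendsto_of_tendsto_of_tendsto_of_le_of_le tendsto_const_nhds
      (h.tendsto_pow_mul ?_) (fun k => zero_le) hle
    exact ENNReal.div_ne_top (ENNReal.mul_ne_top h.lower_ne_top (h.cost_ne_top _ _)) hδ'

variable [CompleteSpace E]

/-- The backward iterates `f (⋯ f (f x₀ ξ_{n-1}) ⋯ ξ_1) ξ_0`. -/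
def backward (f : E → Ω → E) (x₀ : E) : ℕ → (ℕ → Ω) → E
  | 0, _ => x₀
  | n + 1, ω => f (backward f x₀ n fun k => ω (k + 1)) (ω 0)

lemma measurable_backward (hf : Measurable fun p : E × Ω => f p.1 p.2) (x₀ : E) (n : ℕ) :
    Measurable (backward f x₀ n) := by
  induction n with
  | zero => exact measurable_const
  | succ n ih =>
    exact hf.comp ((ih.comp (by fun_prop : Measurable fun (ω : ℕ → Ω) k => ω (k + 1))).prodMk
      (measurable_pi_apply 0))

/-- Prepending one noise variable to a sequence. -/
def consNoise (p : Ω × (ℕ → Ω)) : ℕ → Ω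
  | 0 => p.1
  | n + 1 => p.2 n

lemma measurable_consNoise : Measurable (consNoise (Ω := Ω)) := by
  refine measurable_pi_lambda _ fun n => ?_
  cases n with
  | zero => exact measurable_fst
  | succ n => exact (measurable_pi_apply n).comp measurable_snd

/-- An i.i.d. sequence stays i.i.d. when an independent variable is prepended. On a finite cylinder
the constraint at index `0`, if there is one, splits off as a factor. This is what makes the limit
of the backward iterates stationary. -/
lemma map_consNoise (P : Measure Ω) [IsProbabilityMeasure P] :
    (P.prod (Measure.infinitePi fun _ : ℕ => P)).map consNoise
      = Measure.infinitePi fun _ : ℕ => P := by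
  refine Measure.eq_infinitePi _ fun s t ht => ?_
  classical
  have hb : ∀ {u : Set (ℕ → Ω)}, MeasurableSet u →
      (P.prod (Measure.infinitePi fun _ : ℕ => P)).map consNoise u =
      (P.prod (Measure.infinitePi fun _ : ℕ => P)) (consNoise ⁻¹' u) :=
    fun hu => Measure.map_apply measurable_consNoise hu
  rw [hb (MeasurableSet.pi s.countable_toSet fun i _ => ht i)]
  set t₀ : Set Ω := if 0 ∈ s then t 0 else Set.univ with ht₀
  set s' : Finset ℕ := s.preimage Nat.succ (Nat.succ_injective.injOn) with hs'
  have hpre : consNoise ⁻¹' (Set.pi (s : Set ℕ) t)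
      = t₀ ×ˢ (Set.pi (s' : Set ℕ) fun n => t (n + 1)) := by
    ext p
    simp only [Set.mem_preimage, Set.mem_pi, Finset.mem_coe, Set.mem_prod]
    constructor
    · intro hp
      refine ⟨?_, fun n hn => hp (n + 1) (by simpa [hs'] using hn)⟩
      by_cases h0 : 0 ∈ s
      · simpa [ht₀, h0, consNoise] using hp 0 h0
      · simp [ht₀, h0]
    · rintro ⟨hp0, hp⟩ n hn
      cases n with
      | zero => simpa [ht₀, hn, consNoise] using hp0
      | succ n => exact hp n (by simpa [hs'] using hn)
  rw [hpre, Measure.prod_prod, Measure.infinitePi_pi _ (fun i _ => ht _)]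
  have hs'' : ∏ n ∈ s', P (t (n + 1)) = ∏ n ∈ s.erase 0, P (t n) := by
    refine Finset.prod_bij (fun n _ => n + 1) ?_ ?_ ?_ ?_
    · intro n hn; simpa [hs'] using hn
    · intro a _ b _ hab; simpa using hab
    · intro b hb
      obtain ⟨h0, hb⟩ := Finset.mem_erase.1 hb
      exact ⟨b - 1, by simp [hs', Nat.sub_add_cancel (Nat.pos_of_ne_zero h0), hb],
        Nat.sub_add_cancel (Nat.pos_of_ne_zero h0)⟩
    · intro n _; rfl
  rw [hs'']
  by_cases h0 : 0 ∈ s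
  · rw [← Finset.mul_prod_erase s (fun n => P (t n)) h0]
    simp [ht₀, h0]
  · rw [Finset.erase_eq_of_notMem h0]
    simp [ht₀, h0]

lemma backward_mem (h : IsContractive P f c A r K K') {x₀ : E} (hx₀ : x₀ ∈ A) (n : ℕ)
    (ω : ℕ → Ω) : backward f x₀ n ω ∈ A := by
  induction n generalizing ω with
  | zero => exact hx₀
  | succ n ih => exact h.mapsTo _ (ih _) _

lemma lintegral_infinitePi_cons {φ : (ℕ → Ω) → ℝ≥0∞} (hφ : Measurable φ) :
    ∫⁻ ω, φ ω ∂(Measure.infinitePi fun _ : ℕ => P)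
      = ∫⁻ ω, ∫⁻ ξ, φ (consNoise (ξ, ω)) ∂P ∂(Measure.infinitePi fun _ : ℕ => P) := by
  conv_lhs => rw [← map_consNoise P]
  rw [lintegral_map hφ measurable_consNoise]
  exact lintegral_prod_symm' _ (hφ.comp measurable_consNoise)

/-- Two consecutive backward iterates share their `n` outermost maps and differ only at the
innermost level, by `x₀` against `f x₀ ξ`. Integrating the outermost noise first gains a factor `r`
per level. -/
lemma lintegral_cost_backward_le (h : IsContractive P f c A r K K') {x₀ : E} (hx₀ : x₀ ∈ A)
    (n : ℕ) :
    ∫⁻ ω, c (backward f x₀ n ω, backward f x₀ (n + 1) ω) ∂(Measure.infinitePi fun _ : ℕ => P)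
      ≤ r ^ n * ∫⁻ ξ, c (x₀, f x₀ ξ) ∂P := by
  have hmeas : ∀ n, Measurable fun ω => c (backward f x₀ n ω, backward f x₀ (n + 1) ω) :=
    fun n => h.measurable_cost.comp ((measurable_backward h.measurable_map x₀ n).prodMk
      (measurable_backward h.measurable_map x₀ (n + 1)))
  induction n with
  | zero =>
    rw [lintegral_infinitePi_cons (hmeas 0), pow_zero, one_mul]
    simp [backward, consNoise]
  | succ n ih =>
    rw [lintegral_infinitePi_cons (hmeas (n + 1))]
    calc _ ≤ ∫⁻ ω, r * c (backward f x₀ n ω, backward f x₀ (n + 1) ω)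
          ∂(Measure.infinitePi fun _ : ℕ => P) :=
          lintegral_mono fun ω => h.contract _ (h.backward_mem hx₀ n ω) _
            (h.backward_mem hx₀ (n + 1) ω)
      _ ≤ r * (r ^ n * ∫⁻ ξ, c (x₀, f x₀ ξ) ∂P) := by
          rw [lintegral_const_mul _ (hmeas n)]
          gcongr
      _ = _ := by rw [pow_succ', mul_assoc]

/-- The backward iterates converge in mean square. -/
lemma exists_tendsto_backward (h : IsContractive P f c A r K K') {x₀ : E} (hx₀ : x₀ ∈ A) :
    ∃ X : (ℕ → Ω) → E, Measurable X ∧ MemLp X 2 (Measure.infinitePi fun _ : ℕ => P) ∧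
      Tendsto (fun n => eLpNorm (backward f x₀ n - X) 2 (Measure.infinitePi fun _ : ℕ => P))
        atTop (𝓝 0) := by
  set Q := Measure.infinitePi fun _ : ℕ => P with hQ
  have hm := measurable_backward h.measurable_map x₀
  set M : ℝ≥0∞ := (K * ∫⁻ ξ, c (x₀, f x₀ ξ) ∂P) ^ (2⁻¹ : ℝ) with hM
  have hMtop : M ≠ ∞ := by
    refine ENNReal.rpow_ne_top_of_nonneg (by norm_num) ?_
    exact ENNReal.mul_ne_top h.lower_ne_top (h.start x₀ hx₀)
  have hinc : ∀ n, eLpNorm (backward f x₀ n - backward f x₀ (n + 1)) 2 Q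
      ≤ M * (r ^ (2⁻¹ : ℝ)) ^ n := by
    intro n
    have e1 : eLpNorm (backward f x₀ n - backward f x₀ (n + 1)) 2 Q ^ 2
        ≤ r ^ n * (K * ∫⁻ ξ, c (x₀, f x₀ ξ) ∂P) := by
      rw [eLpNorm_two_sq]
      calc _ ≤ ∫⁻ ω, K * c (backward f x₀ n ω, backward f x₀ (n + 1) ω) ∂Q :=
            lintegral_mono fun ω => h.sq_le_cost _ _
        _ ≤ K * (r ^ n * ∫⁻ ξ, c (x₀, f x₀ ξ) ∂P) := by
            have hcm : Measurable fun ω => c (backward f x₀ n ω, backward f x₀ (n + 1) ω) :=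
              h.measurable_cost.comp ((hm n).prodMk (hm (n + 1)))
            rw [lintegral_const_mul _ hcm]
            gcongr
            exact h.lintegral_cost_backward_le hx₀ n
        _ = _ := by rw [mul_left_comm]
    have e2 : (M * (r ^ (2⁻¹ : ℝ)) ^ n) ^ 2 = r ^ n * (K * ∫⁻ ξ, c (x₀, f x₀ ξ) ∂P) := by
      have hs : ∀ a : ℝ≥0∞, (a ^ (2⁻¹ : ℝ)) ^ 2 = a := by
        intro a
        rw [← ENNReal.rpow_natCast, ← ENNReal.rpow_mul]; simp
      rw [mul_pow, hM, hs, ← pow_mul, mul_comm n 2, pow_mul, hs, mul_comm]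
    rw [← e2] at e1
    exact (ENNReal.pow_le_pow_left_iff two_ne_zero).1 e1
  have hmem : ∀ n, MemLp (backward f x₀ n) 2 Q := by
    intro n
    induction n with
    | zero => exact memLp_const x₀
    | succ n ih =>
      have : MemLp (backward f x₀ n - backward f x₀ (n + 1)) 2 Q :=
        ⟨((hm n).sub (hm (n + 1))).aestronglyMeasurable, (hinc n).trans_lt (by
          refine ENNReal.mul_lt_top hMtop.lt_top (ENNReal.pow_lt_top ?_)
          exact ENNReal.rpow_lt_top_of_nonneg (by norm_num) (h.rate_lt_one.trans_le le_top).ne)⟩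
      simpa using ih.sub this
  have hcau : CauchySeq fun n => (hmem n).toLp := by
    -- The cost is quadratic, so the `L²` norms of the increments decay with ratio `√r`.
    refine cauchySeq_of_edist_le_geometric (r ^ (2⁻¹ : ℝ)) M
      (ENNReal.rpow_lt_one h.rate_lt_one (by norm_num)) hMtop fun n => ?_
    rw [Lp.edist_toLp_toLp]
    exact hinc n
  obtain ⟨Y, hY⟩ := cauchySeq_tendsto_of_complete hcau
  refine ⟨Y, (Lp.stronglyMeasurable Y).measurable, Lp.memLp Y, ?_⟩
  exact (Lp.tendsto_Lp_iff_tendsto_eLpNorm'' _ hmem Y (Lp.memLp Y)).1 (by simpa using hY)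

/-- A contractive random iteration has a stationary distribution with finite second moment. -/
theorem exists_invariant (h : IsContractive P f c A r K K') (hA : A.Nonempty) :
    ∃ ρ : Measure E, IsProbabilityMeasure ρ ∧ (iterKernel P f h.measurable_map).Invariant ρ ∧
      (∀ᵐ x ∂ρ, x ∈ A) ∧ MemLp id 2 ρ := by
  obtain ⟨x₀, hx₀⟩ := hA
  obtain ⟨X, hXm, hX2, hlim⟩ := h.exists_tendsto_backward hx₀
  set Q := Measure.infinitePi fun _ : ℕ => P with hQ
  have hm := measurable_backward h.measurable_map x₀
  -- Mean-square convergence gives an almost surely convergent subsequence, and `A` is closed.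
  have hXA : ∀ᵐ ω ∂Q, X ω ∈ A := by
    obtain ⟨ns, -, hns⟩ := (tendstoInMeasure_of_tendsto_eLpNorm two_ne_zero
      (fun n => (hm n).aestronglyMeasurable) hXm.aestronglyMeasurable hlim).exists_seq_tendsto_ae
    filter_upwards [hns] with ω hω
    exact h.isClosed.mem_of_tendsto hω (.of_forall fun n => h.backward_mem hx₀ _ _)
  have hρ : IsProbabilityMeasure (Q.map X) := Measure.isProbabilityMeasure_map hXm.aemeasurable
  refine ⟨Q.map X, hρ, ?_, ?_, ?_⟩
  · have hF : Measurable fun p : Ω × (ℕ → Ω) => f (X p.2) p.1 :=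
      h.measurable_map.comp ((hXm.comp measurable_snd).prodMk measurable_fst)
    have hG : Measurable fun p : Ω × (ℕ → Ω) => X (consNoise p) := hXm.comp measurable_consNoise
    have hcons : MeasurePreserving (consNoise (Ω := Ω)) (P.prod Q) Q :=
      ⟨measurable_consNoise, map_consNoise P⟩
    -- The limit solves the fixed-point equation `X(ξ, ω) = f(X(ω), ξ)` almost surely: both sides
    -- are compared in `L²` with the backward iterate of order `n + 1`, which is `f` applied to that
    -- of order `n`. Taking laws on both sides gives invariance.
    have hae : (fun p : Ω × (ℕ → Ω) => f (X p.2) p.1) =ᵐ[P.prod Q] fun p => X (consNoise p) := by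
      have hz : eLpNorm ((fun p : Ω × (ℕ → Ω) => f (X p.2) p.1) - fun p => X (consNoise p)) 2
          (P.prod Q) = 0 := by
        have hle : ∀ n, eLpNorm ((fun p : Ω × (ℕ → Ω) => f (X p.2) p.1)
            - fun p => X (consNoise p)) 2 (P.prod Q)
            ≤ (K * (r * K')) ^ (2⁻¹ : ℝ) * eLpNorm (backward f x₀ n - X) 2 Q
              + eLpNorm (backward f x₀ (n + 1) - X) 2 Q := by
          intro n
          have hB : Measurable fun p : Ω × (ℕ → Ω) => f (backward f x₀ n p.2) p.1 :=
            h.measurable_map.comp (((hm n).comp measurable_snd).prodMk measurable_fst)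
          have h1 : eLpNorm (fun p : Ω × (ℕ → Ω) => f (backward f x₀ n p.2) p.1
              - f (X p.2) p.1) 2 (P.prod Q)
              ≤ (K * (r * K')) ^ (2⁻¹ : ℝ) * eLpNorm (backward f x₀ n - X) 2 Q := by
            refine (ENNReal.pow_le_pow_left_iff two_ne_zero).1 ?_
            have hs : ∀ a : ℝ≥0∞, (a ^ (2⁻¹ : ℝ)) ^ 2 = a := by
              intro a
              rw [← ENNReal.rpow_natCast, ← ENNReal.rpow_mul]; simp
            rw [mul_pow, hs, eLpNorm_two_sq, eLpNorm_two_sq]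
            refine (lintegral_prod_symm' _ ((hB.sub hF).enorm.pow_const 2)).le.trans ?_
            rw [← lintegral_const_mul _ (((hm n).sub hXm).enorm.pow_const 2)]
            refine lintegral_mono_ae ?_
            filter_upwards [hXA] with ω hω
            calc _ ≤ ∫⁻ ξ, K * c (f (backward f x₀ n ω) ξ, f (X ω) ξ) ∂P :=
                  lintegral_mono fun ξ => h.sq_le_cost _ _
              _ = K * ∫⁻ ξ, c (f (backward f x₀ n ω) ξ, f (X ω) ξ) ∂P :=
                  lintegral_const_mul _ (h.measurable_cost.comp
                    (measurable_section (measurable_coupledMap h.measurable_map)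
                      (backward f x₀ n ω, X ω)))
              _ ≤ K * (r * (K' * ‖backward f x₀ n ω - X ω‖ₑ ^ 2)) := by
                  gcongr
                  refine (h.contract _ (h.backward_mem hx₀ n ω) _ hω).trans ?_
                  gcongr
                  exact h.cost_le_sq _ _
              _ = _ := by simp only [mul_assoc, Pi.sub_apply]
          have h2 : eLpNorm (fun p : Ω × (ℕ → Ω) => f (backward f x₀ n p.2) p.1
              - X (consNoise p)) 2 (P.prod Q) = eLpNorm (backward f x₀ (n + 1) - X) 2 Q := by
            rw [← eLpNorm_comp_measurePreserving ((hm (n + 1)).sub hXm).aestronglyMeasurable hcons]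
            rfl
          have h3 : ((fun p : Ω × (ℕ → Ω) => f (X p.2) p.1) - fun p => X (consNoise p))
              = (fun p : Ω × (ℕ → Ω) => f (backward f x₀ n p.2) p.1 - X (consNoise p))
                - (fun p : Ω × (ℕ → Ω) => f (backward f x₀ n p.2) p.1 - f (X p.2) p.1) := by
            ext p; simp
          rw [h3]
          refine (eLpNorm_sub_le (hB.sub hG).aestronglyMeasurable
            (hB.sub hF).aestronglyMeasurable (by norm_num)).trans ?_
          rw [add_comm]
          exact add_le_add h1 h2.le
        refine le_antisymm (ge_of_tendsto' (x := atTop) ?_ hle) zero_le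
        have hc : (K * (r * K')) ^ (2⁻¹ : ℝ) ≠ ∞ :=
          ENNReal.rpow_ne_top_of_nonneg (by norm_num) (ENNReal.mul_ne_top h.lower_ne_top
            (ENNReal.mul_ne_top (h.rate_lt_one.trans_le le_top).ne h.upper_ne_top))
        have := (ENNReal.Tendsto.const_mul hlim (Or.inr hc)).add
          (hlim.comp (tendsto_add_atTop_nat 1))
        simpa using this
      have := (eLpNorm_eq_zero_iff (hF.sub hG).aestronglyMeasurable two_ne_zero).1 hz
      filter_upwards [this] with p hp
      exact sub_eq_zero.1 hp
    have e1 : (Q.map X) = (P.prod Q).map fun p => f (X p.2) p.1 := by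
      rw [Measure.map_congr hae]
      conv_lhs => rw [← hcons.map_eq, Measure.map_map hXm measurable_consNoise]
      rfl
    have e2 : (iterKernel P f h.measurable_map) ∘ₘ (Q.map X)
        = (P.prod Q).map fun p => f (X p.2) p.1 := by
      rw [comp_iterKernel, ← Measure.prod_swap, Measure.map_map h.measurable_map measurable_swap]
      conv_lhs => rw [← Measure.map_id (μ := P)]
      rw [Measure.map_prod_map _ _ measurable_id hXm, Measure.map_map
        (h.measurable_map.comp measurable_swap) (measurable_id.prodMap hXm)]
      rfl
    exact e2.trans e1.symm
  · exact (ae_map_iff hXm.aemeasurable h.isClosed.measurableSet).2 hXA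
  · exact (memLp_map_measure_iff aestronglyMeasurable_id hXm.aemeasurable).2 hX2

lemma lintegral_cost_lt_top (h : IsContractive P f c A r K K') {ρ : Measure E}
    [IsProbabilityMeasure ρ] (hρ : MemLp id 2 ρ) (x₀ : E) : ∫⁻ x, c (x₀, x) ∂ρ < ∞ := by
  have hm : MemLp (fun x => x₀ - x) 2 ρ := (memLp_const x₀).sub hρ
  calc ∫⁻ x, c (x₀, x) ∂ρ ≤ ∫⁻ x, K' * ‖x₀ - x‖ₑ ^ 2 ∂ρ := lintegral_mono fun x => h.cost_le_sq _ _
    _ = K' * eLpNorm (fun x => x₀ - x) 2 ρ ^ 2 := by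
      rw [eLpNorm_two_sq, lintegral_const_mul _ (by fun_prop)]
    _ < ∞ := ENNReal.mul_lt_top h.upper_ne_top.lt_top (ENNReal.pow_lt_top hm.2)

/-- Geometric convergence of the chain to its stationary distribution, along couplings. -/
theorem exists_coupling_le (h : IsContractive P f c A r K K') {ρ : Measure E}
    [IsProbabilityMeasure ρ] (hinv : (iterKernel P f h.measurable_map).Invariant ρ)
    (hA : ∀ᵐ x ∂ρ, x ∈ A) {x₀ : E} (hx₀ : x₀ ∈ A) (k : ℕ) :
    ∃ ξ ∈ couplings ((iterKernel P f h.measurable_map ^ k) x₀) ρ,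
      ∫⁻ p, c p ∂ξ ≤ r ^ k * ∫⁻ x, c (x₀, x) ∂ρ := by
  have hm : (Measure.dirac x₀).prod ρ = ρ.map (Prod.mk x₀) := Measure.dirac_prod x₀
  refine ⟨(coupledKernel P f h.measurable_map ^ k : Kernel (E × E) (E × E)) ∘ₘ
    ((Measure.dirac x₀).prod ρ), ⟨?_, ?_⟩, ?_⟩
  · rw [map_fst_coupledKernel_pow, Measure.map_fst_prod, measure_univ, one_smul, comp_dirac_eq]
  · rw [map_snd_coupledKernel_pow, Measure.map_snd_prod, measure_univ, one_smul,
      pow_comp_of_invariant hinv]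
  · have hA' : ∀ᵐ p ∂((Measure.dirac x₀).prod ρ), p.1 ∈ A ∧ p.2 ∈ A := by
      exact (Measure.quasiMeasurePreserving_fst.ae
        ((ae_dirac_iff h.isClosed.measurableSet).2 hx₀)).and
        (Measure.quasiMeasurePreserving_snd.ae hA)
    refine (lintegral_coupledKernel_pow_comp_le h.measurable_cost h.mapsTo h.contract k
      hA').trans_eq ?_
    rw [hm, lintegral_map h.measurable_cost measurable_prodMk_left]

/-- Convergence of second moments of Lipschitz observables to the stationary ones. -/
theorem tendsto_integral_sq (h : IsContractive P f c A r K K') {ρ : Measure E}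
    [IsProbabilityMeasure ρ] (hinv : (iterKernel P f h.measurable_map).Invariant ρ)
    (hA : ∀ᵐ x ∂ρ, x ∈ A) (hρ : MemLp id 2 ρ) {x₀ : E} (hx₀ : x₀ ∈ A)
    {F : Type*} [NormedAddCommGroup F] [SecondCountableTopology F] [MeasurableSpace F]
    [BorelSpace F] {l : E → F} (hl : LipschitzWith 1 l) (hlρ : MemLp l 2 ρ) :
    (∀ k, Integrable (fun x => ‖l x‖ ^ 2) ((iterKernel P f h.measurable_map ^ k) x₀)) ∧
    Tendsto (fun k : ℕ => ∫ x, ‖l x‖ ^ 2 ∂((iterKernel P f h.measurable_map ^ k) x₀)) atTop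
      (𝓝 (∫ x, ‖l x‖ ^ 2 ∂ρ)) := by
  choose ξ hξ hξc using fun k => h.exists_coupling_le hinv hA hx₀ k
  set ν := fun k : ℕ => (iterKernel P f h.measurable_map ^ k) x₀ with hν
  have hlm : Measurable l := hl.continuous.measurable
  have h1 : ∀ k, MeasurePreserving Prod.fst (ξ k) (ν k) := fun k => ⟨measurable_fst, (hξ k).1⟩
  have h2 : ∀ k, MeasurePreserving Prod.snd (ξ k) ρ := fun k => ⟨measurable_snd, (hξ k).2⟩
  set δ := fun k => eLpNorm (fun p : E × E => l p.1 - l p.2) 2 (ξ k) with hδ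
  have hδm : Measurable fun p : E × E => l p.1 - l p.2 :=
    (hlm.comp measurable_fst).sub (hlm.comp measurable_snd)
  have hδle : ∀ k, δ k ^ 2 ≤ r ^ k * (K * ∫⁻ x, c (x₀, x) ∂ρ) := by
    intro k
    rw [hδ]
    simp only
    rw [eLpNorm_two_sq]
    calc ∫⁻ p, ‖l p.1 - l p.2‖ₑ ^ 2 ∂(ξ k) ≤ ∫⁻ p, K * c p ∂(ξ k) := by
          refine lintegral_mono fun p => le_trans ?_ (h.sq_le_cost p.1 p.2)
          have := hl p.1 p.2
          rw [edist_eq_enorm_sub, edist_eq_enorm_sub, ENNReal.coe_one, one_mul] at this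
          exact pow_le_pow_left' this 2
      _ ≤ K * (r ^ k * ∫⁻ x, c (x₀, x) ∂ρ) := by
          rw [lintegral_const_mul _ h.measurable_cost]
          gcongr
          exact hξc k
      _ = _ := by rw [mul_left_comm]
  have hKc : K * ∫⁻ x, c (x₀, x) ∂ρ ≠ ∞ :=
    ENNReal.mul_ne_top h.lower_ne_top (h.lintegral_cost_lt_top hρ x₀).ne
  have hδ0 : Tendsto δ atTop (𝓝 0) := by
    have hsq : Tendsto (fun k => δ k ^ 2) atTop (𝓝 0) :=
      tendsto_of_tendsto_of_tendsto_of_le_of_le tendsto_const_nhds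
        (h.tendsto_pow_mul hKc) (fun _ => zero_le) hδle
    have := hsq.ennrpow_const (2⁻¹ : ℝ)
    simp only [← ENNReal.rpow_natCast, ← ENNReal.rpow_mul] at this
    simpa using this
  have hδtop : ∀ k, δ k ≠ ∞ := by
    intro k hk
    have := hδle k
    rw [hk] at this
    refine absurd (this.trans_lt (ENNReal.mul_lt_top (ENNReal.pow_lt_top
      (h.rate_lt_one.trans_le le_top)) hKc.lt_top)) (by simp)
  have ea : ∀ k, eLpNorm l 2 (ν k) = eLpNorm (fun p : E × E => l p.1) 2 (ξ k) := fun k =>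
    (eLpNorm_comp_measurePreserving hlm.aestronglyMeasurable (h1 k)).symm
  have eb : ∀ k, eLpNorm l 2 ρ = eLpNorm (fun p : E × E => l p.2) 2 (ξ k) := fun k =>
    (eLpNorm_comp_measurePreserving hlm.aestronglyMeasurable (h2 k)).symm
  have hl1 : Measurable fun p : E × E => l p.1 := hlm.comp measurable_fst
  have hl2 : Measurable fun p : E × E => l p.2 := hlm.comp measurable_snd
  -- On the coupling both laws live on one probability space, so by Minkowski the two `L²` norms of
  -- `l` differ by at most `δ k`.
  have up : ∀ k, eLpNorm l 2 (ν k) ≤ eLpNorm l 2 ρ + δ k := by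
    intro k
    rw [ea, eb k]
    refine le_trans (le_of_eq ?_) (eLpNorm_add_le hl2.aestronglyMeasurable
      hδm.aestronglyMeasurable (by norm_num))
    congr 1; ext p; simp
  have low : ∀ k, eLpNorm l 2 ρ - δ k ≤ eLpNorm l 2 (ν k) := by
    intro k
    rw [tsub_le_iff_right, ea, eb k]
    refine le_trans (le_of_eq ?_) (eLpNorm_sub_le hl1.aestronglyMeasurable
      hδm.aestronglyMeasurable (by norm_num))
    congr 1; ext p; simp
  have hmem : ∀ k, MemLp l 2 (ν k) := fun k =>
    ⟨hlm.aestronglyMeasurable, (up k).trans_lt (ENNReal.add_lt_top.2 ⟨hlρ.2, (hδtop k).lt_top⟩)⟩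
  refine ⟨fun k => (hmem k).integrable_norm_pow two_ne_zero, ?_⟩
  have hint : ∀ (μ' : Measure E), MemLp l 2 μ' →
      ∫ x, ‖l x‖ ^ 2 ∂μ' = (eLpNorm l 2 μ' ^ 2).toReal := by
    intro μ' _
    rw [eLpNorm_two_sq, integral_eq_lintegral_of_nonneg_ae (ae_of_all _ fun x => by positivity)
      (hlm.norm.pow_const 2).aestronglyMeasurable]
    congr 1
    refine lintegral_congr fun x => ?_
    rw [ENNReal.ofReal_pow (norm_nonneg _), ofReal_norm]
  rw [hint ρ hlρ]
  refine Tendsto.congr (fun k => (hint _ (hmem k)).symm) ?_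
  refine (ENNReal.tendsto_toReal (ENNReal.pow_ne_top hlρ.2.ne)).comp ?_
  refine ENNReal.Tendsto.pow ?_
  refine tendsto_of_tendsto_of_tendsto_of_le_of_le ?_ ?_ low up
  · simpa using ENNReal.Tendsto.sub (tendsto_const_nhds (x := eLpNorm l 2 ρ)) hδ0
      (Or.inl hlρ.2.ne)
  · simpa using (tendsto_const_nhds (x := eLpNorm l 2 ρ)).add hδ0

end IsContractive
end Contractive
-- Exact second moments of one iteration
section Moments

lemma measurePreserving_mask_eval (d : ℕ) (q : unitInterval) (j : Fin d) :
    MeasurePreserving (fun B : Fin d → ℝ => B j) (maskLaw d q) (bernoulliMeasure (1 : ℝ) 0 q) :=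
  measurePreserving_eval (fun _ : Fin d => bernoulliMeasure (1 : ℝ) 0 q) j

lemma integral_mask_comp (d : ℕ) (q : unitInterval) (j : Fin d) {φ : ℝ → ℝ} (hφ : Measurable φ) :
    ∫ B, φ (B j) ∂(maskLaw d q) = q * φ 1 + (1 - q) * φ 0 := by
  rw [← integral_map (f := φ) (measurePreserving_mask_eval d q j).measurable.aemeasurable
    hφ.aestronglyMeasurable, (measurePreserving_mask_eval d q j).map_eq,
    integral_bernoulliMeasure]
  simp

lemma integrable_mask_comp (d : ℕ) (q : unitInterval) (j : Fin d) {φ : ℝ → ℝ}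
    (hφ : Measurable φ) : Integrable (fun B : Fin d → ℝ => φ (B j)) (maskLaw d q) :=
  ((measurePreserving_mask_eval d q j).integrable_comp hφ.aestronglyMeasurable).2
    (integrable_bernoulliMeasure _ _ _ _)

lemma integral_mask (d : ℕ) (q : unitInterval) (j : Fin d) :
    ∫ B, B j ∂(maskLaw d q) = q := by
  simpa using integral_mask_comp d q j measurable_id

lemma integral_mask_sq (d : ℕ) (q : unitInterval) (j : Fin d) :
    ∫ B, B j ^ 2 ∂(maskLaw d q) = q := by
  rw [integral_mask_comp d q j (φ := fun t => t ^ 2) (by fun_prop)]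
  ring

lemma integrable_mask_sq (d : ℕ) (q : unitInterval) (j : Fin d) :
    Integrable (fun B : Fin d → ℝ => B j ^ 2) (maskLaw d q) :=
  integrable_mask_comp d q j (φ := fun t => t ^ 2) (by fun_prop)

/-- Moments of a square-integrable variable multiplied by an independent rescaled mask entry. -/
lemma masked_moments {Y : Type*} [MeasurableSpace Y] (S : Measure Y) [IsProbabilityMeasure S]
    {d : ℕ} {q : unitInterval} (hq : 0 < (q : ℝ)) (j : Fin d) {x : Y → ℝ} (hx : MemLp x 2 S) :
    MemLp (fun p : Y × (Fin d → ℝ) => (q : ℝ)⁻¹ * (p.2 j * x p.1)) 2 (S.prod (maskLaw d q)) ∧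
    ∫ p, (q : ℝ)⁻¹ * (p.2 j * x p.1) ∂(S.prod (maskLaw d q)) = ∫ y, x y ∂S ∧
    ∫ p, ((q : ℝ)⁻¹ * (p.2 j * x p.1)) ^ 2 ∂(S.prod (maskLaw d q))
      = (q : ℝ)⁻¹ * ∫ y, x y ^ 2 ∂S := by
  have hm : AEStronglyMeasurable (fun p : Y × (Fin d → ℝ) => (q : ℝ)⁻¹ * (p.2 j * x p.1))
      (S.prod (maskLaw d q)) := by
    have h2 : Measurable fun p : Y × (Fin d → ℝ) => p.2 j := by fun_prop
    exact (h2.aestronglyMeasurable.mul hx.1.comp_fst).const_mul _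
  have e2 : ∀ p : Y × (Fin d → ℝ), ((q : ℝ)⁻¹ * (p.2 j * x p.1)) ^ 2
      = ((q : ℝ)⁻¹) ^ 2 * (x p.1 ^ 2 * p.2 j ^ 2) := fun p => by ring
  refine ⟨?_, ?_, ?_⟩
  · rw [memLp_two_iff_integrable_sq hm]
    simp_rw [e2]
    exact (hx.integrable_sq.mul_prod (integrable_mask_sq d q j)).const_mul _
  · rw [integral_const_mul]
    simp_rw [mul_comm _ (x _)]
    rw [integral_prod_mul (μ := S) (ν := maskLaw d q) x fun B => B j, integral_mask]
    field_simp
  · simp_rw [e2]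
    rw [integral_const_mul, integral_prod_mul (μ := S) (ν := maskLaw d q) (fun y => x y ^ 2)
      fun B => B j ^ 2, integral_mask_sq]
    field_simp

/-- Mean and second moment of a sum of independent square-integrable variables. -/
lemma pi_sum_moments {ι : Type*} [Fintype ι] {Y : ι → Type*} [∀ i, MeasurableSpace (Y i)]
    (S : ∀ i, Measure (Y i)) [∀ i, IsProbabilityMeasure (S i)] {x : ∀ i, Y i → ℝ}
    (hx : ∀ i, MemLp (x i) 2 (S i)) :
    MemLp (fun ω : ∀ i, Y i => ∑ i, x i (ω i)) 2 (Measure.pi S) ∧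
    ∫ ω, ∑ i, x i (ω i) ∂(Measure.pi S) = ∑ i, ∫ y, x i y ∂(S i) ∧
    ∫ ω, (∑ i, x i (ω i)) ^ 2 ∂(Measure.pi S) = (∑ i, ∫ y, x i y ∂(S i)) ^ 2
      + ∑ i, (∫ y, x i y ^ 2 ∂(S i) - (∫ y, x i y ∂(S i)) ^ 2) := by
  have h1 : ∀ i, MemLp (fun ω : ∀ i, Y i => x i (ω i)) 2 (Measure.pi S) := fun i =>
    (hx i).comp_measurePreserving (measurePreserving_eval S i)
  have hM : MemLp (fun ω : ∀ i, Y i => ∑ i, x i (ω i)) 2 (Measure.pi S) :=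
    memLp_finsetSum _ fun i _ => h1 i
  have hE : ∫ ω, ∑ i, x i (ω i) ∂(Measure.pi S) = ∑ i, ∫ y, x i y ∂(S i) := by
    rw [integral_finsetSum _ fun i _ => (h1 i).integrable one_le_two]
    refine Finset.sum_congr rfl fun i _ => ?_
    have hp := measurePreserving_eval S i
    conv_rhs => rw [← hp.map_eq]
    rw [integral_map hp.measurable.aemeasurable (by rw [hp.map_eq]; exact (hx i).1)]
  refine ⟨hM, hE, ?_⟩
  have hv := variance_sum_pi hx
  have e1 : (∑ i, fun ω : ∀ i, Y i => x i (ω i)) = fun ω => ∑ i, x i (ω i) := by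
    ext ω; simp
  rw [e1, variance_eq_sub hM, hE] at hv
  have e2 : ∀ i, Var[x i; S i] = ∫ y, x i y ^ 2 ∂(S i) - (∫ y, x i y ∂(S i)) ^ 2 := by
    intro i; rw [variance_eq_sub (hx i)]; rfl
  simp_rw [e2] at hv
  have e3 : ∫ ω, (∑ i, x i (ω i)) ^ 2 ∂(Measure.pi S)
    = ∫ ω, ((fun ω : ∀ i, Y i => ∑ i, x i (ω i)) ^ 2) ω ∂(Measure.pi S) := rfl
  rw [e3]
  linarith

variable {d N : ℕ} {Z : Type*} [MeasurableSpace Z]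

lemma sparsify_apply (q : ℝ) (B : Fin d → ℝ) (x : Param d) (j : Fin d) :
    sparsify q B x j = q⁻¹ * (B j * x j) := rfl

/-- Linearity for a fixed mask is what allows two copies sharing their masks to approach each other.
-/
lemma sparsify_sub (q : ℝ) (B : Fin d → ℝ) (x y : Param d) :
    sparsify q B (x - y) = sparsify q B x - sparsify q B y := by
  ext j
  simp only [sparsify_apply, PiLp.sub_apply]
  ring

/-- Coordinatewise mean and second moment of the aggregated uplink messages. -/
lemma aggregate_moments (S : Fin N → Measure Z) [∀ i, IsProbabilityMeasure (S i)]
    {q : unitInterval} (hq : 0 < (q : ℝ)) (j : Fin d) {x : Fin N → Z → ℝ}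
    (hx : ∀ i, MemLp (x i) 2 (S i)) (e : Fin N → ℝ) :
    let T := fun p : (Fin N → Z) × (Fin N → Fin d → ℝ) =>
      (N : ℝ)⁻¹ * ∑ i, ((q : ℝ)⁻¹ * (p.2 i j * x i (p.1 i)) + e i)
    let μ := (Measure.pi S).prod (Measure.pi fun _ : Fin N => maskLaw d q)
    MemLp T 2 μ ∧ ∫ p, T p ∂μ = (N : ℝ)⁻¹ * ∑ i, (∫ z, x i z ∂(S i) + e i) ∧
    ∫ p, T p ^ 2 ∂μ = ((N : ℝ)⁻¹ * ∑ i, (∫ z, x i z ∂(S i) + e i)) ^ 2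
      + ((N : ℝ)⁻¹) ^ 2 * ∑ i, ((q : ℝ)⁻¹ * ∫ z, x i z ^ 2 ∂(S i) - (∫ z, x i z ∂(S i)) ^ 2) := by
  intro T μ
  -- Regrouping the noise as one pair (sample, mask) per worker turns the aggregate into a sum of
  -- independent variables.
  have hp := measurePreserving_arrowProdEquivProdArrow Z (Fin d → ℝ) (Fin N) S
    (fun _ => maskLaw d q)
  set y : Fin N → Z × (Fin d → ℝ) → ℝ := fun i p => (q : ℝ)⁻¹ * (p.2 j * x i p.1) + e i
  have hmm := fun i => masked_moments (S i) hq j (hx i)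
  have hy : ∀ i, MemLp (y i) 2 ((S i).prod (maskLaw d q)) := fun i =>
    (hmm i).1.add (memLp_const _)
  have hy1 : ∀ i, ∫ p, y i p ∂((S i).prod (maskLaw d q)) = ∫ z, x i z ∂(S i) + e i := by
    intro i
    rw [integral_add ((hmm i).1.integrable one_le_two) (integrable_const _), (hmm i).2.1]
    simp
  have hy2 : ∀ i, ∫ p, y i p ^ 2 ∂((S i).prod (maskLaw d q))
      = (q : ℝ)⁻¹ * ∫ z, x i z ^ 2 ∂(S i) + 2 * e i * ∫ z, x i z ∂(S i) + e i ^ 2 := by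
    intro i
    have : ∀ p, y i p ^ 2 = ((q : ℝ)⁻¹ * (p.2 j * x i p.1)) ^ 2
        + 2 * e i * ((q : ℝ)⁻¹ * (p.2 j * x i p.1)) + e i ^ 2 := fun p => by
      simp only [y]; ring
    simp_rw [this]
    rw [integral_add _ (integrable_const _), integral_add (hmm i).1.integrable_sq,
      integral_const_mul, (hmm i).2.1, (hmm i).2.2]
    · simp
    · exact ((hmm i).1.integrable one_le_two).const_mul _
    · exact (hmm i).1.integrable_sq.add (((hmm i).1.integrable one_le_two).const_mul _)
  obtain ⟨hM, hE, hV⟩ := pi_sum_moments (fun i => (S i).prod (maskLaw d q)) hy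
  have hT : ∀ ω, T (MeasurableEquiv.arrowProdEquivProdArrow Z (Fin d → ℝ) (Fin N) ω)
    = (N : ℝ)⁻¹ * ∑ i, y i (ω i) := fun ω => rfl
  have hmem : MemLp T 2 μ := by
    rw [show μ = _ from hp.map_eq.symm, MeasurableEquiv.memLp_map_measure_iff]
    exact hM.const_mul _
  refine ⟨hmem, ?_, ?_⟩
  · rw [← hp.integral_comp' T]
    simp_rw [hT]
    rw [integral_const_mul, hE]
    simp_rw [hy1]
  · rw [← hp.integral_comp' fun p => T p ^ 2]
    simp_rw [hT, mul_pow]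
    rw [integral_const_mul, hV]
    simp_rw [hy1, hy2]
    rw [mul_add]
    congr 2
    refine Finset.sum_congr rfl fun i _ => ?_
    ring

/-- The law of the noise of one iteration. -/
noncomputable abbrev noiseMeasure (S : Fin N → Measure Z) (qu qd : unitInterval) :
    Measure (Noise d N Z) :=
  (Measure.pi S).prod ((Measure.pi fun _ : Fin N => maskLaw d qu).prod (maskLaw d qd))

/-- The new model obtained from the error `δ`, the messages `a i` and the memories `e i`. -/
noncomputable def modelUpdate (qu qd : ℝ) (γ : ℝ) (δ : Param d) (a : Fin N → Z → Param d)
    (e : Fin N → Param d) (ξ : Noise d N Z) : Param d :=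
  δ - γ • sparsify qd ξ.2.2
    ((N : ℝ)⁻¹ • ∑ i, (sparsify qu (ξ.2.1 i) (a i (ξ.1 i)) + e i))

lemma sum_update_algebra (δ M R : Fin d → ℝ) (γ q n : ℝ) :
    ∑ j, (δ j ^ 2 - 2 * γ * δ j * M j + γ ^ 2 * (q * (M j ^ 2 + n * R j)))
      = ∑ j, δ j ^ 2 - 2 * γ * ∑ j, δ j * M j + γ ^ 2 * q * (∑ j, M j ^ 2 + n * ∑ j, R j) := by
  rw [Finset.sum_add_distrib, Finset.sum_sub_distrib, ← Finset.mul_sum, ← Finset.mul_sum,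
    Finset.sum_add_distrib, ← Finset.mul_sum, Finset.mul_sum (a := 2 * γ)]
  simp only [mul_assoc]

/-- Second moment of the model after one iteration. -/
lemma modelUpdate_moment (S : Fin N → Measure Z) [∀ i, IsProbabilityMeasure (S i)]
    {qu qd : unitInterval} (hqu : 0 < (qu : ℝ)) (hqd : 0 < (qd : ℝ)) (γ : ℝ) (δ : Param d)
    {a : Fin N → Z → Param d} (ha : ∀ i, MemLp (a i) 2 (S i)) (e : Fin N → Param d) :
    Integrable (fun ξ => ‖modelUpdate qu qd γ δ a e ξ‖ ^ 2) (noiseMeasure (d := d) S qu qd) ∧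
    ∫ ξ, ‖modelUpdate qu qd γ δ a e ξ‖ ^ 2 ∂(noiseMeasure (d := d) S qu qd)
      = ‖δ‖ ^ 2 - 2 * γ * inner ℝ ((N : ℝ)⁻¹ • ∑ i, (∫ z, a i z ∂(S i) + e i)) δ
        + γ ^ 2 * (qd : ℝ)⁻¹ * (‖(N : ℝ)⁻¹ • ∑ i, (∫ z, a i z ∂(S i) + e i)‖ ^ 2
          + ((N : ℝ)⁻¹) ^ 2 * ∑ i, ((qu : ℝ)⁻¹ * ∫ z, ‖a i z‖ ^ 2 ∂(S i)
            - ‖∫ z, a i z ∂(S i)‖ ^ 2)) := by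
  set ν := (Measure.pi S).prod (Measure.pi fun _ : Fin N => maskLaw d qu)
  -- Reassociation groups the samples with the uplink masks, so that the downlink mask multiplies an
  -- aggregate independent of it. The squared norm is a sum over coordinates, so only the marginals
  -- of the masks enter.
  have hassoc := measurePreserving_prodAssoc (Measure.pi S)
    (Measure.pi fun _ : Fin N => maskLaw d qu) (maskLaw d qd)
  have haj : ∀ i j, MemLp (fun z => a i z j) 2 (S i) := fun i j => (ha i).eval_piLp j
  have hI : ∀ i j, (∫ z, a i z ∂(S i)) j = ∫ z, a i z j ∂(S i) := fun i j =>
    eval_integral_piLp (fun j => (haj i j).integrable one_le_two) j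
  set T : Fin d → (Fin N → Z) × (Fin N → Fin d → ℝ) → ℝ := fun j p =>
    (N : ℝ)⁻¹ * ∑ i, ((qu : ℝ)⁻¹ * (p.2 i j * a i (p.1 i) j) + e i j) with hTdef
  have hT := fun j => aggregate_moments S hqu j (x := fun i z => a i z j) (fun i => haj i j)
    (fun i => e i j)
  have hmm := fun j => masked_moments ν hqd j (hT j).1
  have hm1 : ∀ j, ∫ ξ, (qd : ℝ)⁻¹ * (ξ.2 j * T j ξ.1) ∂(ν.prod (maskLaw d qd))
      = (N : ℝ)⁻¹ * ∑ i, (∫ z, a i z j ∂(S i) + e i j) := fun j =>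
    (hmm j).2.1.trans (hT j).2.1
  have hm2 : ∀ j, ∫ ξ, ((qd : ℝ)⁻¹ * (ξ.2 j * T j ξ.1)) ^ 2 ∂(ν.prod (maskLaw d qd))
      = (qd : ℝ)⁻¹ * (((N : ℝ)⁻¹ * ∑ i, (∫ z, a i z j ∂(S i) + e i j)) ^ 2
          + ((N : ℝ)⁻¹) ^ 2 * ∑ i, ((qu : ℝ)⁻¹ * ∫ z, a i z j ^ 2 ∂(S i)
            - (∫ z, a i z j ∂(S i)) ^ 2)) := fun j =>
    (hmm j).2.2.trans (congrArg ((qd : ℝ)⁻¹ * ·) (hT j).2.2)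
  have hU : ∀ ξ : ((Fin N → Z) × (Fin N → Fin d → ℝ)) × (Fin d → ℝ),
      ‖modelUpdate qu qd γ δ a e (MeasurableEquiv.prodAssoc ξ)‖ ^ 2
      = ∑ j, (δ j ^ 2 - 2 * γ * δ j * ((qd : ℝ)⁻¹ * (ξ.2 j * T j ξ.1))
        + γ ^ 2 * ((qd : ℝ)⁻¹ * (ξ.2 j * T j ξ.1)) ^ 2) := by
    intro ξ
    rw [EuclideanSpace.real_norm_sq_eq]
    refine Finset.sum_congr rfl fun j _ => ?_
    have : modelUpdate qu qd γ δ a e (MeasurableEquiv.prodAssoc ξ) j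
        = δ j - γ * ((qd : ℝ)⁻¹ * (ξ.2 j * T j ξ.1)) := by
      simp [modelUpdate, sparsify_apply, hTdef, MeasurableEquiv.prodAssoc]
    rw [this]; ring
  have i1 : ∀ j, Integrable (fun ξ : ((Fin N → Z) × (Fin N → Fin d → ℝ)) × (Fin d → ℝ) =>
      δ j ^ 2 - 2 * γ * δ j * ((qd : ℝ)⁻¹ * (ξ.2 j * T j ξ.1))) (ν.prod (maskLaw d qd)) :=
    fun j => (integrable_const _).sub (((hmm j).1.integrable one_le_two).const_mul _)
  have i2 : ∀ j, Integrable (fun ξ : ((Fin N → Z) × (Fin N → Fin d → ℝ)) × (Fin d → ℝ) =>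
      γ ^ 2 * ((qd : ℝ)⁻¹ * (ξ.2 j * T j ξ.1)) ^ 2) (ν.prod (maskLaw d qd)) :=
    fun j => (hmm j).1.integrable_sq.const_mul _
  have i12 : ∀ j, Integrable (fun ξ : ((Fin N → Z) × (Fin N → Fin d → ℝ)) × (Fin d → ℝ) =>
      δ j ^ 2 - 2 * γ * δ j * ((qd : ℝ)⁻¹ * (ξ.2 j * T j ξ.1))
        + γ ^ 2 * ((qd : ℝ)⁻¹ * (ξ.2 j * T j ξ.1)) ^ 2) (ν.prod (maskLaw d qd)) :=
    fun j => (i1 j).add (i2 j)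
  constructor
  · rw [← hassoc.integrable_comp_emb MeasurableEquiv.prodAssoc.measurableEmbedding]
    refine (integrable_finsetSum Finset.univ fun j _ => i12 j).congr
      (ae_of_all _ fun ξ => (hU ξ).symm)
  · rw [← hassoc.integral_comp']
    simp_rw [hU]
    rw [integral_finsetSum _ fun j _ => i12 j]
    have hj : ∀ j, ∫ ξ, (δ j ^ 2 - 2 * γ * δ j * ((qd : ℝ)⁻¹ * (ξ.2 j * T j ξ.1))
        + γ ^ 2 * ((qd : ℝ)⁻¹ * (ξ.2 j * T j ξ.1)) ^ 2) ∂(ν.prod (maskLaw d qd))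
        = δ j ^ 2 - 2 * γ * δ j * ((N : ℝ)⁻¹ * ∑ i, (∫ z, a i z j ∂(S i) + e i j))
        + γ ^ 2 * ((qd : ℝ)⁻¹ * (((N : ℝ)⁻¹ * ∑ i, (∫ z, a i z j ∂(S i) + e i j)) ^ 2
          + ((N : ℝ)⁻¹) ^ 2 * ∑ i, ((qu : ℝ)⁻¹ * ∫ z, a i z j ^ 2 ∂(S i)
            - (∫ z, a i z j ∂(S i)) ^ 2))) := by
      intro j
      rw [integral_add (i1 j) (i2 j), integral_sub (integrable_const _)
        (((hmm j).1.integrable one_le_two).const_mul _), integral_const_mul (2 * γ * δ j),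
        integral_const_mul (γ ^ 2),
        hm1 j, hm2 j]
      simp
    simp_rw [hj]
    have hsq : ∀ i, ∫ z, ‖a i z‖ ^ 2 ∂(S i) = ∑ j, ∫ z, a i z j ^ 2 ∂(S i) := by
      intro i
      simp_rw [EuclideanSpace.real_norm_sq_eq]
      exact integral_finsetSum _ fun j _ => (haj i j).integrable_sq
    have hcomm : ∑ i, ((qu : ℝ)⁻¹ * ∫ z, ‖a i z‖ ^ 2 ∂(S i) - ‖∫ z, a i z ∂(S i)‖ ^ 2)
        = ∑ j, ∑ i, ((qu : ℝ)⁻¹ * ∫ z, a i z j ^ 2 ∂(S i) - (∫ z, a i z j ∂(S i)) ^ 2) := by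
      rw [Finset.sum_comm]
      refine Finset.sum_congr rfl fun i _ => ?_
      rw [hsq, EuclideanSpace.real_norm_sq_eq, Finset.sum_sub_distrib, Finset.mul_sum]
      simp_rw [hI]
    have hy : ∀ j, ((N : ℝ)⁻¹ • ∑ i, (∫ z, a i z ∂(S i) + e i)) j
        = (N : ℝ)⁻¹ * ∑ i, (∫ z, a i z j ∂(S i) + e i j) := by
      intro j
      simp only [PiLp.smul_apply, WithLp.ofLp_sum, Finset.sum_apply, PiLp.add_apply, hI,
        smul_eq_mul]
    rw [hcomm, EuclideanSpace.real_norm_sq_eq, EuclideanSpace.real_norm_sq_eq, PiLp.inner_apply]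
    simp_rw [hy]
    simp only [RCLike.inner_apply, conj_trivial]
    exact sum_update_algebra _ _ _ _ _ _

/-- Second moment of a memory after one iteration. -/
lemma memoryUpdate_moment (S : Fin N → Measure Z) [∀ i, IsProbabilityMeasure (S i)]
    {qu : unitInterval} (qd : unitInterval) (hqu : 0 < (qu : ℝ)) (α : ℝ) (i : Fin N)
    {a : Z → Param d} (ha : MemLp a 2 (S i)) (e : Param d) :
    Integrable (fun ξ : Noise d N Z => ‖e + α • sparsify qu (ξ.2.1 i) (a (ξ.1 i))‖ ^ 2)
      (noiseMeasure (d := d) S qu qd) ∧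
    ∫ ξ, ‖e + α • sparsify qu (ξ.2.1 i) (a (ξ.1 i))‖ ^ 2 ∂(noiseMeasure (d := d) S qu qd)
      = ‖e‖ ^ 2 + 2 * α * inner ℝ e (∫ z, a z ∂(S i))
        + α ^ 2 * ((qu : ℝ)⁻¹ * ∫ z, ‖a z‖ ^ 2 ∂(S i)) := by
  have hp : MeasurePreserving (fun ξ : Noise d N Z => (ξ.1 i, ξ.2.1 i))
      (noiseMeasure (d := d) S qu qd) ((S i).prod (maskLaw d qu)) :=
    (measurePreserving_eval S i).prod ((measurePreserving_eval (fun _ : Fin N => maskLaw d qu) i).comp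
      measurePreserving_fst)
  have haj : ∀ j, MemLp (fun z => a z j) 2 (S i) := fun j => ha.eval_piLp j
  have hI : ∀ j, (∫ z, a z ∂(S i)) j = ∫ z, a z j ∂(S i) := fun j =>
    eval_integral_piLp (fun j => (haj j).integrable one_le_two) j
  have hmm := fun j => masked_moments (S i) hqu j (haj j)
  set G : Z × (Fin d → ℝ) → ℝ := fun p => ‖e + α • sparsify qu p.2 (a p.1)‖ ^ 2 with hG
  have hU : ∀ p, G p = ∑ j, (e j ^ 2 + 2 * α * e j * ((qu : ℝ)⁻¹ * (p.2 j * a p.1 j))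
        + α ^ 2 * ((qu : ℝ)⁻¹ * (p.2 j * a p.1 j)) ^ 2) := by
    intro p
    simp only [hG]
    rw [EuclideanSpace.real_norm_sq_eq]
    refine Finset.sum_congr rfl fun j _ => ?_
    simp only [PiLp.add_apply, PiLp.smul_apply, sparsify_apply, smul_eq_mul]
    ring
  have i1 : ∀ j, Integrable (fun p : Z × (Fin d → ℝ) =>
      e j ^ 2 + 2 * α * e j * ((qu : ℝ)⁻¹ * (p.2 j * a p.1 j))) ((S i).prod (maskLaw d qu)) :=
    fun j => (integrable_const _).add (((hmm j).1.integrable one_le_two).const_mul _)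
  have i2 : ∀ j, Integrable (fun p : Z × (Fin d → ℝ) =>
      α ^ 2 * ((qu : ℝ)⁻¹ * (p.2 j * a p.1 j)) ^ 2) ((S i).prod (maskLaw d qu)) :=
    fun j => (hmm j).1.integrable_sq.const_mul _
  have i12 : ∀ j, Integrable (fun p : Z × (Fin d → ℝ) =>
      e j ^ 2 + 2 * α * e j * ((qu : ℝ)⁻¹ * (p.2 j * a p.1 j))
        + α ^ 2 * ((qu : ℝ)⁻¹ * (p.2 j * a p.1 j)) ^ 2) ((S i).prod (maskLaw d qu)) :=
    fun j => (i1 j).add (i2 j)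
  have hGint : Integrable G ((S i).prod (maskLaw d qu)) :=
    (integrable_finsetSum Finset.univ fun j _ => i12 j).congr
      (ae_of_all _ fun p => (hU p).symm)
  refine ⟨hp.integrable_comp_of_integrable hGint, ?_⟩
  have e1 : ∫ ξ, ‖e + α • sparsify qu (ξ.2.1 i) (a (ξ.1 i))‖ ^ 2 ∂(noiseMeasure (d := d) S qu qd)
      = ∫ p, G p ∂((S i).prod (maskLaw d qu)) := by
    rw [← hp.map_eq, integral_map hp.measurable.aemeasurable
      (by rw [hp.map_eq]; exact hGint.aestronglyMeasurable)]
  rw [e1]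
  simp_rw [hU]
  rw [integral_finsetSum _ fun j _ => i12 j]
  have hj : ∀ j, ∫ p, (e j ^ 2 + 2 * α * e j * ((qu : ℝ)⁻¹ * (p.2 j * a p.1 j))
        + α ^ 2 * ((qu : ℝ)⁻¹ * (p.2 j * a p.1 j)) ^ 2) ∂((S i).prod (maskLaw d qu))
      = e j ^ 2 + 2 * α * e j * ∫ z, a z j ∂(S i)
        + α ^ 2 * ((qu : ℝ)⁻¹ * ∫ z, a z j ^ 2 ∂(S i)) := by
    intro j
    rw [integral_add (i1 j) (i2 j), integral_add (integrable_const _)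
      (((hmm j).1.integrable one_le_two).const_mul _), integral_const_mul (2 * α * e j),
      integral_const_mul (α ^ 2),
      (hmm j).2.1, (hmm j).2.2]
    simp
  simp_rw [hj]
  have hsq : ∫ z, ‖a z‖ ^ 2 ∂(S i) = ∑ j, ∫ z, a z j ^ 2 ∂(S i) := by
    simp_rw [EuclideanSpace.real_norm_sq_eq]
    exact integral_finsetSum _ fun j _ => (haj j).integrable_sq
  rw [hsq, EuclideanSpace.real_norm_sq_eq, PiLp.inner_apply]
  simp only [hI, RCLike.inner_apply, conj_trivial]
  simp only [Finset.mul_sum, Finset.sum_add_distrib]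
  congr 2
  refine Finset.sum_congr rfl fun j _ => ?_
  ring

end Moments
-- Hilbert-space inequalities and consequences of the assumptions
/-- The variance identity for a square-integrable vector. -/
lemma integral_norm_sub_sq {Y H : Type*} [MeasurableSpace Y] [NormedAddCommGroup H]
    [InnerProductSpace ℝ H] [CompleteSpace H] (S : Measure Y) [IsProbabilityMeasure S] {x : Y → H}
    (hx : MemLp x 2 S) (e : H) :
    ∫ y, ‖x y - e‖ ^ 2 ∂S = ∫ y, ‖x y‖ ^ 2 ∂S - 2 * inner ℝ (∫ y, x y ∂S) e + ‖e‖ ^ 2 := by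
  have hi := hx.integrable one_le_two
  have hn := hx.integrable_norm_pow two_ne_zero
  simp_rw [norm_sub_sq_real]
  have h2 : Integrable (fun y => 2 * inner ℝ (x y) e) S := (hi.inner_const e).const_mul 2
  rw [integral_add (f := fun y => ‖x y‖ ^ 2 - 2 * inner ℝ (x y) e) (hn.sub h2)
    (integrable_const _), integral_sub hn h2, integral_const_mul]
  have e1 : ∫ y, inner ℝ (x y) e ∂S = inner ℝ (∫ y, x y ∂S) e := by
    simp_rw [real_inner_comm e]
    exact integral_inner hi e
  rw [e1]
  simp

lemma norm_integral_sq_le {Y H : Type*} [MeasurableSpace Y] [NormedAddCommGroup H]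
    [InnerProductSpace ℝ H] [CompleteSpace H] (S : Measure Y) [IsProbabilityMeasure S] {x : Y → H}
    (hx : MemLp x 2 S) : ‖∫ y, x y ∂S‖ ^ 2 ≤ ∫ y, ‖x y‖ ^ 2 ∂S := by
  have h := integral_norm_sub_sq S hx (∫ y, x y ∂S)
  rw [real_inner_self_eq_norm_sq] at h
  have : 0 ≤ ∫ y, ‖x y - ∫ y, x y ∂S‖ ^ 2 ∂S := integral_nonneg fun y => by positivity
  linarith

/-- Convexity of the squared norm, for a uniform average. -/
lemma norm_average_sq_le {H : Type*} [NormedAddCommGroup H] [NormedSpace ℝ H] {N : ℕ}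
    (x : Fin N → H) : ‖(N : ℝ)⁻¹ • ∑ i, x i‖ ^ 2 ≤ (N : ℝ)⁻¹ * ∑ i, ‖x i‖ ^ 2 := by
  rcases Nat.eq_zero_or_pos N with rfl | hN
  · simp
  have hN' : (0 : ℝ) < N := by exact_mod_cast hN
  have h1 : ‖∑ i, x i‖ ^ 2 ≤ N * ∑ i, ‖x i‖ ^ 2 := by
    calc ‖∑ i, x i‖ ^ 2 ≤ (∑ i, ‖x i‖) ^ 2 := by gcongr; exact norm_sum_le _ _
      _ ≤ _ := by simpa using sq_sum_le_card_mul_sum_sq (s := Finset.univ) (f := fun i => ‖x i‖)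
  rw [norm_smul, mul_pow, Real.norm_of_nonneg (by positivity)]
  calc ((N : ℝ)⁻¹) ^ 2 * ‖∑ i, x i‖ ^ 2 ≤ ((N : ℝ)⁻¹) ^ 2 * (N * ∑ i, ‖x i‖ ^ 2) := by gcongr
    _ = _ := by field_simp

namespace Problem

variable {d N b : ℕ} {Z : Type*} [MeasurableSpace Z] {P : Problem d N Z} {μ L σ : ℝ}
  {wopt : Param d}

namespace Assumptions

lemma gradient_objective (h : P.Assumptions μ L σ b wopt) (w : Param d) :
    gradient P.objective w = (N : ℝ)⁻¹ • ∑ i, gradient (P.F i) w := by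
  refine HasGradientAt.gradient ?_
  rw [hasGradientAt_iff_hasFDerivAt]
  have h1 := (HasFDerivAt.fun_sum (u := Finset.univ) (fun i _ =>
    (h.differentiable i w).hasGradientAt.hasFDerivAt)).const_mul (N : ℝ)⁻¹
  convert! h1 using 1
  simp [map_sum]

lemma gradient_objective_wopt (h : P.Assumptions μ L σ b wopt) :
    gradient P.objective wopt = 0 := by
  have : IsLocalMin P.objective wopt := Filter.Eventually.of_forall h.optimal
  rw [gradient, this.fderiv_eq_zero]
  simp

/-- Sum of the strong convexity inequalities at `(w, u)` and `(u, w)`. -/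
lemma strong_monotone (h : P.Assumptions μ L σ b wopt) (w u : Param d) :
    μ * ‖w - u‖ ^ 2 ≤
      inner ℝ ((N : ℝ)⁻¹ • ∑ i, (gradient (P.F i) w - gradient (P.F i) u)) (w - u) := by
  have e : (N : ℝ)⁻¹ • ∑ i, (gradient (P.F i) w - gradient (P.F i) u)
      = gradient P.objective w - gradient P.objective u := by
    rw [h.gradient_objective, h.gradient_objective, Finset.sum_sub_distrib, smul_sub]
  rw [e]
  have h1 := h.strongConvex w u
  have h2 := h.strongConvex u w
  rw [norm_sub_rev] at h1
  have e1 : inner ℝ (u - w) (gradient P.objective w)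
      = - inner ℝ (gradient P.objective w) (w - u) := by
    rw [← inner_neg_right, neg_sub, real_inner_comm]
  rw [e1] at h1
  rw [real_inner_comm] at h2
  rw [inner_sub_left]
  linarith

lemma memLp_sub (h : P.Assumptions μ L σ b wopt) (i : Fin N) (w u : Param d) :
    MemLp (fun z => P.g i w z - P.g i u z) 2 (P.sampleLaw i) :=
  (h.memLp i w).sub (h.memLp i u)

lemma integral_sub_eq (h : P.Assumptions μ L σ b wopt) (i : Fin N) (w u : Param d) :
    ∫ z, (P.g i w z - P.g i u z) ∂(P.sampleLaw i) = gradient (P.F i) w - gradient (P.F i) u := by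
  rw [integral_sub ((h.memLp i w).integrable one_le_two) ((h.memLp i u).integrable one_le_two),
    h.unbiased, h.unbiased]

lemma norm_gradient_sub_sq_le (h : P.Assumptions μ L σ b wopt) (i : Fin N) (w u : Param d) :
    ‖gradient (P.F i) w - gradient (P.F i) u‖ ^ 2
      ≤ ∫ z, ‖P.g i w z - P.g i u z‖ ^ 2 ∂(P.sampleLaw i) := by
  rw [← h.integral_sub_eq]
  exact norm_integral_sq_le _ (h.memLp_sub i w u)

lemma sum_cocoercive (h : P.Assumptions μ L σ b wopt) (hN : 0 < N) (w u : Param d) :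
    ∑ i, ∫ z, ‖P.g i w z - P.g i u z‖ ^ 2 ∂(P.sampleLaw i)
      ≤ L * (N * inner ℝ ((N : ℝ)⁻¹ • ∑ i, (gradient (P.F i) w - gradient (P.F i) u)) (w - u)) := by
  have hN' : (N : ℝ) ≠ 0 := by exact_mod_cast hN.ne'
  rw [real_inner_smul_left, mul_inv_cancel_left₀ hN', sum_inner, Finset.mul_sum]
  exact Finset.sum_le_sum fun i _ => h.cocoercive i w u

lemma norm_average_gradient_sub_sq_le (h : P.Assumptions μ L σ b wopt) (hN : 0 < N)
    (w u : Param d) :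
    ‖(N : ℝ)⁻¹ • ∑ i, (gradient (P.F i) w - gradient (P.F i) u)‖ ^ 2
      ≤ L * inner ℝ ((N : ℝ)⁻¹ • ∑ i, (gradient (P.F i) w - gradient (P.F i) u)) (w - u) := by
  have hN' : (0 : ℝ) < N := by exact_mod_cast hN
  calc _ ≤ (N : ℝ)⁻¹ * ∑ i, ‖gradient (P.F i) w - gradient (P.F i) u‖ ^ 2 := norm_average_sq_le _
    _ ≤ (N : ℝ)⁻¹ * ∑ i, ∫ z, ‖P.g i w z - P.g i u z‖ ^ 2 ∂(P.sampleLaw i) := by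
        gcongr with i; exact h.norm_gradient_sub_sq_le i w u
    _ ≤ (N : ℝ)⁻¹ * (L * (N * inner ℝ ((N : ℝ)⁻¹ • ∑ i, (gradient (P.F i) w
          - gradient (P.F i) u)) (w - u))) := by
        gcongr; exact h.sum_cocoercive hN w u
    _ = _ := by field_simp

end Assumptions

/-- Squared distance of two states, memories being scaled by `τ`. -/
noncomputable def sqDist (τ : ℝ) (x y : State d N) : ℝ :=
  ‖x.1 - y.1‖ ^ 2 + τ ^ 2 * ∑ i, ‖x.2 i - y.2 i‖ ^ 2

lemma sqDist_nonneg (τ : ℝ) (x y : State d N) : 0 ≤ sqDist τ x y := by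
  unfold sqDist; positivity

/-- The difference of two synchronous copies is again a model update, so one moment formula serves
both for contraction and for the distance to a fixed point. -/
lemma step_fst_sub (P : Problem d N Z) (v : Variant) (γ : ℝ) (x y : State d N)
    (ξ : Noise d N Z) :
    (P.step v γ x ξ).1 - (P.step v γ y ξ).1 = modelUpdate v.qUp v.qDwn γ (x.1 - y.1)
      (fun i z => P.g i x.1 z - P.g i y.1 z - (x.2 i - y.2 i)) (fun i => x.2 i - y.2 i) ξ := by
  have e : ∀ i, P.compressedDiff v x ξ i + x.2 i - (P.compressedDiff v y ξ i + y.2 i)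
      = sparsify v.qUp (ξ.2.1 i) (P.g i x.1 (ξ.1 i) - P.g i y.1 (ξ.1 i) - (x.2 i - y.2 i))
        + (x.2 i - y.2 i) := by
    intro i
    rw [show P.g i x.1 (ξ.1 i) - P.g i y.1 (ξ.1 i) - (x.2 i - y.2 i)
      = (P.g i x.1 (ξ.1 i) - x.2 i) - (P.g i y.1 (ξ.1 i) - y.2 i) by abel, sparsify_sub]
    simp only [compressedDiff]
    abel
  simp only [step, modelUpdate]
  simp_rw [← e]
  rw [Finset.sum_sub_distrib, smul_sub, sparsify_sub, smul_sub]
  abel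

lemma step_snd_sub (P : Problem d N Z) (v : Variant) (γ : ℝ) (x y : State d N)
    (ξ : Noise d N Z) (i : Fin N) :
    (P.step v γ x ξ).2 i - (P.step v γ y ξ).2 i = (x.2 i - y.2 i) + v.α •
      sparsify v.qUp (ξ.2.1 i) (P.g i x.1 (ξ.1 i) - P.g i y.1 (ξ.1 i) - (x.2 i - y.2 i)) := by
  rw [show P.g i x.1 (ξ.1 i) - P.g i y.1 (ξ.1 i) - (x.2 i - y.2 i)
      = (P.g i x.1 (ξ.1 i) - x.2 i) - (P.g i y.1 (ξ.1 i) - y.2 i) by abel, sparsify_sub, smul_sub]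
  simp only [step, compressedDiff]
  abel

/-- Mean squared distance after one iteration of two copies driven by the same noise. -/
lemma integral_sqDist_step (h : P.Assumptions μ L σ b wopt) {v : Variant} (hv : v.Valid)
    (γ τ : ℝ) (x y : State d N) :
    Integrable (fun ξ => sqDist τ (P.step v γ x ξ) (P.step v γ y ξ)) (P.noiseLaw v) ∧
    ∫ ξ, sqDist τ (P.step v γ x ξ) (P.step v γ y ξ) ∂(P.noiseLaw v)
      = ‖x.1 - y.1‖ ^ 2 - 2 * γ * inner ℝ ((N : ℝ)⁻¹ • ∑ i, (gradient (P.F i) x.1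
            - gradient (P.F i) y.1)) (x.1 - y.1)
        + γ ^ 2 * (v.qDwn : ℝ)⁻¹ * (‖(N : ℝ)⁻¹ • ∑ i, (gradient (P.F i) x.1
            - gradient (P.F i) y.1)‖ ^ 2
          + ((N : ℝ)⁻¹) ^ 2 * ∑ i, ((v.qUp : ℝ)⁻¹ *
              ∫ z, ‖P.g i x.1 z - P.g i y.1 z - (x.2 i - y.2 i)‖ ^ 2 ∂(P.sampleLaw i)
            - ‖gradient (P.F i) x.1 - gradient (P.F i) y.1 - (x.2 i - y.2 i)‖ ^ 2))
        + τ ^ 2 * ∑ i, (‖x.2 i - y.2 i‖ ^ 2 + 2 * v.α * inner ℝ (x.2 i - y.2 i)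
            (gradient (P.F i) x.1 - gradient (P.F i) y.1 - (x.2 i - y.2 i))
          + v.α ^ 2 * ((v.qUp : ℝ)⁻¹ *
              ∫ z, ‖P.g i x.1 z - P.g i y.1 z - (x.2 i - y.2 i)‖ ^ 2 ∂(P.sampleLaw i))) := by
  have ha : ∀ i, MemLp (fun z => P.g i x.1 z - P.g i y.1 z - (x.2 i - y.2 i)) 2
      (P.sampleLaw i) := fun i => (h.memLp_sub i x.1 y.1).sub (memLp_const _)
  have hI : ∀ i, ∫ z, (P.g i x.1 z - P.g i y.1 z - (x.2 i - y.2 i)) ∂(P.sampleLaw i)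
      = gradient (P.F i) x.1 - gradient (P.F i) y.1 - (x.2 i - y.2 i) := by
    intro i
    rw [integral_sub ((h.memLp_sub i x.1 y.1).integrable one_le_two) (integrable_const _),
      h.integral_sub_eq]
    simp
  obtain ⟨m1, m2⟩ := modelUpdate_moment P.sampleLaw hv.qUp_pos hv.qDwn_pos γ (x.1 - y.1) ha
    (fun i => x.2 i - y.2 i)
  have hmem := fun i => memoryUpdate_moment P.sampleLaw v.qDwn hv.qUp_pos v.α i (ha i)
    (x.2 i - y.2 i)
  simp only [sqDist, step_fst_sub, step_snd_sub]
  have hs := (integrable_finsetSum Finset.univ fun i _ => (hmem i).1).const_mul (τ ^ 2)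
  refine ⟨m1.add hs, ?_⟩
  have e0 : P.noiseLaw v = noiseMeasure P.sampleLaw v.qUp v.qDwn := rfl
  rw [e0, integral_add m1 hs, integral_const_mul, integral_finsetSum _ fun i _ => (hmem i).1, m2]
  simp_rw [fun i => (hmem i).2, hI, sub_add_cancel]

end Problem
-- Contraction in one step
/-- Choice of the weight of the memories in the Lyapunov function: `R = τ² α`. -/
lemma exists_memory_weight {ω α p γμ : ℝ} (hω : 0 ≤ ω) (hα : 0 < α) (hp : 0 < p)
    (h1 : 1 ≤ 2 * (α * (ω + 1))) (h3 : 2 * (α * (ω + 1)) < 3)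
    (hγ : 2 * γμ ≤ α * (3 - 2 * (α * (ω + 1)))) :
    ∃ R : ℝ, 0 < R ∧ (p + 2 * R) * (3 - 2 * (α * (ω + 1)))
        ≤ p * (2 * (3 - 2 * (α * (ω + 1))) + 8 * ω) ∧
      ∀ SD Sd Sc Se : ℝ, 0 ≤ Sd → Sd ≤ SD → 0 ≤ Se → 2 * Sc ≤ Sd + Se → -(2 * Sc) ≤ Sd + Se →
        p * ((ω + 1) * SD - Sd - 2 * ω * Sc + ω * Se)
          + R / α * (2 * α * (Sc - Se) + α ^ 2 * ((ω + 1) * (SD - 2 * Sc + Se)))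
          + γμ * (R / α * Se) ≤ (p + 2 * R) * SD := by
  set β := α * (ω + 1) with hβ
  have hs : 0 < 3 - 2 * β := by linarith
  -- The third step-size condition replaces `γμ` by `α(3 - 2β)/2`, which cancels the division by `α`
  -- and leaves an inequality in `β` alone.
  have key : ∀ R : ℝ, 0 < R → ∀ SD Sc Se : ℝ, 0 ≤ Se →
      R / α * (2 * α * (Sc - Se) + α ^ 2 * ((ω + 1) * (SD - 2 * Sc + Se))) + γμ * (R / α * Se)
        ≤ R * (2 * (Sc - Se) + β * (SD - 2 * Sc + Se)) + R * ((3 - 2 * β) / 2 * Se) := by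
    intro R hR SD Sc Se hSe
    have e1 : R / α * (2 * α * (Sc - Se) + α ^ 2 * ((ω + 1) * (SD - 2 * Sc + Se)))
        = R * (2 * (Sc - Se) + β * (SD - 2 * Sc + Se)) := by
      rw [hβ]; field_simp
    have e2 : γμ * (R / α * Se) ≤ α * (3 - 2 * β) / 2 * (R / α * Se) := by
      have : 0 ≤ R / α * Se := by positivity
      exact mul_le_mul_of_nonneg_right (by linarith) this
    have e3 : α * (3 - 2 * β) / 2 * (R / α * Se) = R * ((3 - 2 * β) / 2 * Se) := by field_simp
    rw [e1]; linarith
  rcases hω.eq_or_lt with h0 | h0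
  -- Without uplink compression the general choice of `R` would vanish, but a positive weight is
  -- needed. The value `p / 2` makes the first requirement an equality, and `1/2 ≤ β ≤ 3/2` gives
  -- `|1 - β| ≤ 1/2` for the cross term.
  · refine ⟨p / 2, by positivity, ?_, ?_⟩
    · rw [← h0]; nlinarith
    · intro SD Sd Sc Se hSd hSD hSe hc1 hc2
      have hk := key (p / 2) (by positivity) SD Sc Se hSe
      have hb1 : β ≤ 3 / 2 := by linarith
      have hb2 : 1 / 2 ≤ β := by linarith
      have e : (1 - β) * (2 * Sc) ≤ 1 / 2 * (Sd + Se) := by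
        have hn : 0 ≤ Sd + Se := by linarith
        rcases le_total β 1 with hb | hb
        · nlinarith
        · nlinarith
      have e' : β * SD ≤ 3 / 2 * SD := mul_le_mul_of_nonneg_right hb1 (hSd.trans hSD)
      have : 2 * (Sc - Se) + β * (SD - 2 * Sc + Se) + (3 - 2 * β) / 2 * Se ≤ 2 * SD := by
        nlinarith
      have h2 := mul_le_mul_of_nonneg_left this (by positivity : 0 ≤ p / 2)
      rw [← h0] at hk ⊢
      nlinarith
  -- With this `R`, both `Se` and `2 Sc` have the coefficient `-R(β/2 - 1/4)`, which is nonpositive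
  -- as `β ≥ 1/2`. Bounding `-2 Sc` by `Sd + Se` then cancels `Se` exactly; `Sd ≤ SD` and `β ≤ 3/2`
  -- bound the rest by `(p + 2R) SD`.
  · set R := 4 * p * ω / (3 - 2 * β) with hR
    have hRpos : 0 < R := by positivity
    have hRs : R * (3 - 2 * β) = 4 * p * ω := by rw [hR]; field_simp
    refine ⟨R, hRpos, by nlinarith, ?_⟩
    intro SD Sd Sc Se hSd hSD hSe hc1 hc2
    have hk := key R hRpos SD Sc Se hSe
    have hpω : p * ω = R * (3 - 2 * β) / 4 := by linarith
    have e1 : p * ((ω + 1) * SD - Sd - 2 * ω * Sc + ω * Se)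
        = p * (SD - Sd) + R * (3 - 2 * β) / 4 * (SD - 2 * Sc + Se) := by
      rw [← hpω]; ring
    have e2 : R * ((β / 2 - 1 / 4) * (-(2 * Sc))) ≤ R * ((β / 2 - 1 / 4) * (Sd + Se)) := by
      gcongr
      linarith
    have e3 : R * ((β / 2 - 1 / 4) * Sd) ≤ R * ((β / 2 - 1 / 4) * SD) := by
      gcongr
      linarith
    have e4 : R * (β * SD) ≤ R * (3 / 2 * SD) := by
      have := hSd.trans hSD
      gcongr
      linarith
    have e5 : 0 ≤ p * Sd := by positivity
    linarith

namespace Problem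

variable {d N b : ℕ} {Z : Type*} [MeasurableSpace Z] {P : Problem d N Z} {μ L σ : ℝ}
  {wopt : Param d}

namespace Assumptions

/-- With memory, one iteration contracts a weighted squared distance. -/
lemma exists_contraction_memory (h : P.Assumptions μ L σ b wopt) (hN : 0 < N) (hL : 0 < L)
    {v : Variant} (hv : v.Valid) (hα : v.α ≠ 0) {γ : ℝ} (hγ : v.StepSize N μ L γ) :
    ∃ τ : ℝ, 0 < τ ∧ ∀ x y : State d N,
      ∫ ξ, sqDist τ (P.step v γ x ξ) (P.step v γ y ξ) ∂(P.noiseLaw v)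
        ≤ (1 - γ * μ) * sqDist τ x y := by
  have hN' : (1 : ℝ) ≤ N := by exact_mod_cast hN
  obtain ⟨hg1, hg2, hg3⟩ := hγ.memory hα
  have hγ0 := hγ.pos
  set Q := (v.qUp : ℝ)⁻¹ with hQ
  set A := (v.qDwn : ℝ)⁻¹ with hA
  have hω : v.ωUp + 1 = Q := by simp [Variant.ωUp, hQ]
  have hωd : v.ωDwn + 1 = A := by simp [Variant.ωDwn, hA]
  have hQ1 : 1 ≤ Q := (one_le_inv₀ hv.qUp_pos).2 v.qUp.2.2
  have hA1 : 1 ≤ A := (one_le_inv₀ hv.qDwn_pos).2 v.qDwn.2.2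
  rw [hω, hωd] at hg1
  rw [hω, hωd] at hg2
  rw [hω] at hg3
  obtain ⟨ha1, ha2⟩ := hv.α_range.resolve_left hα
  rw [hω] at ha1 ha2
  have hαpos : 0 < v.α := lt_of_lt_of_le (by positivity) ha1
  rw [div_le_iff₀ (by positivity)] at ha1
  rw [lt_div_iff₀ (by positivity)] at ha2
  have hD : 0 < A * (N + 4 * Q - 2) * L := by
    have : 0 < (N : ℝ) + 4 * Q - 2 := by linarith
    positivity
  rw [lt_div_iff₀ hD] at hg1
  set y := γ * L * A with hy
  have hy0 : 0 < y := by positivity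
  have hy1 : y * (N + 4 * Q - 2) < N := by rw [hy]; linarith
  -- As `Q ≥ 1`, the first step-size condition makes the denominator in the second one positive.
  have hy2 : 0 < N - y * (N + 2) := by nlinarith
  rw [lt_div_iff₀ (by positivity)] at hg2
  obtain ⟨R, hR, hRs, hRineq⟩ := exists_memory_weight (ω := Q - 1) (α := v.α)
    (p := γ ^ 2 * A * ((N : ℝ)⁻¹) ^ 2) (γμ := γ * μ) (by linarith) hαpos (by positivity)
    (by rw [sub_add_cancel]; linarith) (by rw [sub_add_cancel]; linarith)
    (by rw [sub_add_cancel]; linarith)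
  rw [sub_add_cancel] at hRs
  simp only [sub_add_cancel] at hRineq
  set p := γ ^ 2 * A * ((N : ℝ)⁻¹) ^ 2 with hp
  set s := 3 - 2 * (v.α * Q) with hs
  have hs0 : 0 < s := by rw [hs]; linarith
  -- `τ² = R / α`.
  refine ⟨Real.sqrt (R / v.α), Real.sqrt_pos.2 (by positivity), fun x u => ?_⟩
  rw [(integral_sqDist_step h hv γ _ x u).2]
  unfold sqDist
  rw [Real.sq_sqrt (by positivity)]
  have hsub : ∀ i, ∫ z, ‖P.g i x.1 z - P.g i u.1 z - (x.2 i - u.2 i)‖ ^ 2 ∂(P.sampleLaw i)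
      = ∫ z, ‖P.g i x.1 z - P.g i u.1 z‖ ^ 2 ∂(P.sampleLaw i)
        - 2 * inner ℝ (gradient (P.F i) x.1 - gradient (P.F i) u.1) (x.2 i - u.2 i)
        + ‖x.2 i - u.2 i‖ ^ 2 := by
    intro i
    rw [integral_norm_sub_sq _ (h.memLp_sub i x.1 u.1), h.integral_sub_eq]
  simp_rw [hsub]
  have hX1 := h.strong_monotone x.1 u.1
  have hX2 := h.sum_cocoercive hN x.1 u.1
  have hX3 := h.norm_average_gradient_sub_sq_le hN x.1 u.1
  set X := inner ℝ ((N : ℝ)⁻¹ • ∑ i, (gradient (P.F i) x.1 - gradient (P.F i) u.1)) (x.1 - u.1)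
  set M := ‖(N : ℝ)⁻¹ • ∑ i, (gradient (P.F i) x.1 - gradient (P.F i) u.1)‖ ^ 2
  set G := fun i => gradient (P.F i) x.1 - gradient (P.F i) u.1 with hG
  set e := fun i => x.2 i - u.2 i with he
  set D := fun i => ∫ z, ‖P.g i x.1 z - P.g i u.1 z‖ ^ 2 ∂(P.sampleLaw i) with hDdef
  have hGD : ∀ i, ‖G i‖ ^ 2 ≤ D i := fun i => h.norm_gradient_sub_sq_le i x.1 u.1
  have hin : ∀ i, 2 * inner ℝ (G i) (e i) ≤ ‖G i‖ ^ 2 + ‖e i‖ ^ 2 := fun i => by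
    have := norm_sub_sq_real (G i) (e i)
    have := sq_nonneg ‖G i - e i‖
    linarith
  have hin' : ∀ i, -(2 * inner ℝ (G i) (e i)) ≤ ‖G i‖ ^ 2 + ‖e i‖ ^ 2 := fun i => by
    have := norm_add_sq_real (G i) (e i)
    have := sq_nonneg ‖G i + e i‖
    linarith
  have hXnn : 0 ≤ X := by
    have h0 : 0 ≤ L * X := (by positivity : 0 ≤ M).trans hX3
    exact nonneg_of_mul_nonneg_right h0 hL
  have hmain := hRineq (∑ i, D i) (∑ i, ‖G i‖ ^ 2) (∑ i, inner ℝ (G i) (e i)) (∑ i, ‖e i‖ ^ 2)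
    (by positivity) (Finset.sum_le_sum fun i _ => hGD i) (by positivity)
    (by rw [Finset.mul_sum, ← Finset.sum_add_distrib]; exact Finset.sum_le_sum fun i _ => hin i)
    (by
      rw [Finset.mul_sum, ← Finset.sum_add_distrib, ← Finset.sum_neg_distrib]
      exact Finset.sum_le_sum fun i _ => hin' i)
  have s1 : ∑ i, (Q * (D i - 2 * inner ℝ (G i) (e i) + ‖e i‖ ^ 2) - ‖G i - e i‖ ^ 2)
      = Q * ∑ i, D i - ∑ i, ‖G i‖ ^ 2 - 2 * (Q - 1) * ∑ i, inner ℝ (G i) (e i)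
        + (Q - 1) * ∑ i, ‖e i‖ ^ 2 := by
    simp only [Finset.mul_sum, ← Finset.sum_add_distrib, ← Finset.sum_sub_distrib]
    refine Finset.sum_congr rfl fun i _ => ?_
    rw [norm_sub_sq_real (G i) (e i)]; ring
  have s2 : ∑ i, (‖e i‖ ^ 2 + 2 * v.α * inner ℝ (e i) (G i - e i)
        + v.α ^ 2 * (Q * (D i - 2 * inner ℝ (G i) (e i) + ‖e i‖ ^ 2)))
      = ∑ i, ‖e i‖ ^ 2 + (2 * v.α * (∑ i, inner ℝ (G i) (e i) - ∑ i, ‖e i‖ ^ 2)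
        + v.α ^ 2 * (Q * (∑ i, D i - 2 * ∑ i, inner ℝ (G i) (e i) + ∑ i, ‖e i‖ ^ 2))) := by
    simp only [Finset.mul_sum, ← Finset.sum_add_distrib, ← Finset.sum_sub_distrib]
    refine Finset.sum_congr rfl fun i _ => ?_
    rw [inner_sub_right, real_inner_self_eq_norm_sq, real_inner_comm]; ring
  rw [s1, s2]
  have hpR : (p + 2 * R) * (∑ i, D i) ≤ (p + 2 * R) * (L * (N * X)) := by gcongr
  have hM : γ ^ 2 * A * M ≤ γ ^ 2 * A * (L * X) := by gcongr
  -- All terms of order `γ²` fit into half of the descent term `2γX`.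
  have hfin : γ ^ 2 * A * (L * X) + (p + 2 * R) * (L * (N * X)) ≤ γ * X := by
    -- This is the second step-size condition with its denominator cleared, written in terms of `s =
    -- 3 - 2αQ`.
    have hadm : y * ((N + 2) * s + 8 * (Q - 1)) ≤ N * s := by rw [hs]; nlinarith
    have e1 : (p + 2 * R) * N * s ≤ γ ^ 2 * A * (N : ℝ)⁻¹ * (2 * s + 8 * (Q - 1)) := by
      calc (p + 2 * R) * N * s = N * ((p + 2 * R) * s) := by ring
        _ ≤ N * (p * (2 * s + 8 * (Q - 1))) := by gcongr
        _ = _ := by rw [hp]; field_simp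
    have e2 : (γ ^ 2 * A * L + (p + 2 * R) * L * N) * s ≤ γ * s := by
      calc (γ ^ 2 * A * L + (p + 2 * R) * L * N) * s
          = γ ^ 2 * A * L * s + L * ((p + 2 * R) * N * s) := by ring
        _ ≤ γ ^ 2 * A * L * s + L * (γ ^ 2 * A * (N : ℝ)⁻¹ * (2 * s + 8 * (Q - 1))) := by gcongr
        _ = γ * (N : ℝ)⁻¹ * (y * ((N + 2) * s + 8 * (Q - 1))) := by rw [hy]; field_simp; ring
        _ ≤ γ * (N : ℝ)⁻¹ * (N * s) := by gcongr
        _ = γ * s := by field_simp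
    have e3 := le_of_mul_le_mul_right e2 hs0
    calc _ = (γ ^ 2 * A * L + (p + 2 * R) * L * N) * X := by ring
      _ ≤ γ * X := by gcongr
  have hμX : γ * (μ * ‖x.1 - u.1‖ ^ 2) ≤ γ * X := by gcongr
  have epq : γ ^ 2 * A * (((N : ℝ)⁻¹) ^ 2 * (Q * ∑ i, D i - ∑ i, ‖G i‖ ^ 2
      - 2 * (Q - 1) * ∑ i, inner ℝ (G i) (e i) + (Q - 1) * ∑ i, ‖e i‖ ^ 2))
      = p * (Q * ∑ i, D i - ∑ i, ‖G i‖ ^ 2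
      - 2 * (Q - 1) * ∑ i, inner ℝ (G i) (e i) + (Q - 1) * ∑ i, ‖e i‖ ^ 2) := by
    rw [hp]; ring
  rw [mul_add (γ ^ 2 * A), epq, mul_add (R / v.α)]
  linarith

/-- Without memory, one iteration contracts the squared distance of two models. -/
lemma contraction_noMemory (h : P.Assumptions μ L σ b wopt) (hN : 0 < N) (hL : 0 < L)
    {v : Variant} (hv : v.Valid) (hα : v.α = 0) {γ : ℝ} (hγ : v.StepSize N μ L γ)
    {x u : State d N} (hx : ∀ i, x.2 i = 0) (hu : ∀ i, u.2 i = 0) :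
    ∫ ξ, sqDist 1 (P.step v γ x ξ) (P.step v γ u ξ) ∂(P.noiseLaw v)
        ≤ (1 - γ * μ) * sqDist 1 x u := by
  have hN' : (1 : ℝ) ≤ N := by exact_mod_cast hN
  have hg1 := hγ.noMemory hα
  have hγ0 := hγ.pos
  set Q := (v.qUp : ℝ)⁻¹ with hQ
  set A := (v.qDwn : ℝ)⁻¹ with hA
  have hω : v.ωUp + 1 = Q := by simp [Variant.ωUp, hQ]
  have hωd : v.ωDwn + 1 = A := by simp [Variant.ωDwn, hA]
  have hQ1 : 1 ≤ Q := (one_le_inv₀ hv.qUp_pos).2 v.qUp.2.2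
  have hA1 : 1 ≤ A := (one_le_inv₀ hv.qDwn_pos).2 v.qDwn.2.2
  rw [hω, hωd, le_div_iff₀ (by positivity)] at hg1
  rw [(integral_sqDist_step h hv γ _ x u).2]
  unfold sqDist
  have hX1 := h.strong_monotone x.1 u.1
  have hX2 := h.sum_cocoercive hN x.1 u.1
  have hX3 := h.norm_average_gradient_sub_sq_le hN x.1 u.1
  simp only [hx, hu, hα, sub_self, sub_zero, norm_zero, inner_zero_left]
  set X := inner ℝ ((N : ℝ)⁻¹ • ∑ i, (gradient (P.F i) x.1 - gradient (P.F i) u.1)) (x.1 - u.1)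
  set M := ‖(N : ℝ)⁻¹ • ∑ i, (gradient (P.F i) x.1 - gradient (P.F i) u.1)‖ ^ 2
  have hXnn : 0 ≤ X := by
    have h0 : 0 ≤ L * X := (by positivity : 0 ≤ M).trans hX3
    exact nonneg_of_mul_nonneg_right h0 hL
  have hM : γ ^ 2 * A * M ≤ γ ^ 2 * A * (L * X) := by gcongr
  have hV : ∑ i, (Q * ∫ z, ‖P.g i x.1 z - P.g i u.1 z‖ ^ 2 ∂(P.sampleLaw i)
      - ‖gradient (P.F i) x.1 - gradient (P.F i) u.1‖ ^ 2) ≤ Q * (L * (N * X)) := by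
    refine le_trans ?_ (mul_le_mul_of_nonneg_left hX2 (by positivity))
    rw [Finset.mul_sum]
    exact Finset.sum_le_sum fun i _ => sub_le_self _ (by positivity)
  have hV' : γ ^ 2 * A * (((N : ℝ)⁻¹) ^ 2 * ∑ i, (Q * ∫ z, ‖P.g i x.1 z - P.g i u.1 z‖ ^ 2
      ∂(P.sampleLaw i) - ‖gradient (P.F i) x.1 - gradient (P.F i) u.1‖ ^ 2))
      ≤ γ ^ 2 * A * (((N : ℝ)⁻¹) ^ 2 * (Q * (L * (N * X)))) := by gcongr
  have hfin : γ ^ 2 * A * (L * X) + γ ^ 2 * A * (((N : ℝ)⁻¹) ^ 2 * (Q * (L * (N * X))))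
      ≤ γ * X := by
    -- The step-size condition has `2Q` in place of `Q`; a single `Q` suffices for contraction.
    have e1 : γ * (L * A * (N + Q)) ≤ N :=
      le_trans (by gcongr; linarith) hg1
    calc _ = γ * (N : ℝ)⁻¹ * (γ * (L * A * (N + Q))) * X := by field_simp
      _ ≤ γ * (N : ℝ)⁻¹ * N * X := by gcongr
      _ = γ * X := by field_simp
  have hμX : γ * (μ * ‖x.1 - u.1‖ ^ 2) ≤ γ * X := by gcongr
  rw [mul_add (γ ^ 2 * A)]
  simp only [ne_eq, OfNat.ofNat_ne_zero, not_false_eq_true, zero_pow, mul_zero, zero_mul, add_zero,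
    Finset.sum_const_zero]
  linarith

end Assumptions
end Problem
-- Limit distribution of the algorithm
namespace Problem

variable {d N b : ℕ} {Z : Type*} [MeasurableSpace Z] {P : Problem d N Z} {μ L σ : ℝ}
  {wopt : Param d}

/-- The state space carries the sup norm of a product, whereas the contraction holds for a weighted
Euclidean distance. The two are compared here and in `sqDist_le_norm_sq`, with constants depending
on `τ` and `N`. -/
lemma norm_sq_le_sqDist {τ : ℝ} (hτ : 0 < τ) (x y : State d N) :
    ‖x - y‖ ^ 2 ≤ (1 + (τ ^ 2)⁻¹) * sqDist τ x y := by
  set S := ∑ i, ‖x.2 i - y.2 i‖ ^ 2 with hS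
  have hS0 : 0 ≤ S := by positivity
  have h1 : ‖(x - y).2‖ ^ 2 ≤ S := by
    have : ‖(x - y).2‖ ≤ Real.sqrt S := by
      refine (pi_norm_le_iff_of_nonneg (Real.sqrt_nonneg _)).2 fun i => ?_
      refine Real.le_sqrt_of_sq_le ?_
      exact Finset.single_le_sum (f := fun i => ‖x.2 i - y.2 i‖ ^ 2) (fun i _ => by positivity)
        (Finset.mem_univ i)
    calc ‖(x - y).2‖ ^ 2 ≤ Real.sqrt S ^ 2 := by gcongr
      _ = S := Real.sq_sqrt hS0
  have e : (1 + (τ ^ 2)⁻¹) * sqDist τ x y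
      = ‖x.1 - y.1‖ ^ 2 + S + (τ ^ 2 * S + (τ ^ 2)⁻¹ * ‖x.1 - y.1‖ ^ 2) := by
    rw [sqDist, ← hS]; field_simp; ring
  rw [e]
  have h2 : 0 ≤ τ ^ 2 * S + (τ ^ 2)⁻¹ * ‖x.1 - y.1‖ ^ 2 := by positivity
  rw [Prod.norm_def]
  rcases max_cases ‖(x - y).1‖ ‖(x - y).2‖ with ⟨h, -⟩ | ⟨h, -⟩ <;> rw [h]
  · rw [Prod.fst_sub]; linarith
  · have : 0 ≤ ‖x.1 - y.1‖ ^ 2 := by positivity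
    linarith

lemma sqDist_le_norm_sq (τ : ℝ) (x y : State d N) :
    sqDist τ x y ≤ (1 + τ ^ 2 * N) * ‖x - y‖ ^ 2 := by
  have h1 : ‖x.1 - y.1‖ ≤ ‖x - y‖ := norm_fst_le (x - y)
  have h2 : ∀ i, ‖x.2 i - y.2 i‖ ≤ ‖x - y‖ := fun i =>
    (norm_le_pi_norm (x - y).2 i).trans (norm_snd_le (x - y))
  have h3 : ∑ i, ‖x.2 i - y.2 i‖ ^ 2 ≤ N * ‖x - y‖ ^ 2 := by
    calc ∑ i, ‖x.2 i - y.2 i‖ ^ 2 ≤ ∑ _i : Fin N, ‖x - y‖ ^ 2 := by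
          gcongr with i; exact h2 i
      _ = _ := by simp
  unfold sqDist
  calc ‖x.1 - y.1‖ ^ 2 + τ ^ 2 * ∑ i, ‖x.2 i - y.2 i‖ ^ 2
      ≤ ‖x - y‖ ^ 2 + τ ^ 2 * (N * ‖x - y‖ ^ 2) := by gcongr
    _ = _ := by ring

lemma continuous_sqDist (τ : ℝ) : Continuous fun p : State d N × State d N => sqDist τ p.1 p.2 := by
  unfold sqDist
  fun_prop

/-- Here the second term is a fixed point and not another copy of the chain, so the messages keep
their full noise. This drives both the integrability of one step and the lower bound. -/
lemma step_fst_sub_const (P : Problem d N Z) (v : Variant) (γ : ℝ) (x : State d N)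
    (ξ : Noise d N Z) (w : Param d) :
    (P.step v γ x ξ).1 - w = modelUpdate v.qUp v.qDwn γ (x.1 - w)
      (fun i z => P.g i x.1 z - x.2 i) x.2 ξ := by
  simp only [step, modelUpdate, compressedDiff]
  abel

namespace Assumptions

lemma memLp_message (h : P.Assumptions μ L σ b wopt) (i : Fin N) (x : State d N) :
    MemLp (fun z => P.g i x.1 z - x.2 i) 2 (P.sampleLaw i) :=
  (h.memLp i x.1).sub (memLp_const _)

lemma integral_message (h : P.Assumptions μ L σ b wopt) (i : Fin N) (x : State d N) :
    ∫ z, (P.g i x.1 z - x.2 i) ∂(P.sampleLaw i) = gradient (P.F i) x.1 - x.2 i := by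
  rw [integral_sub ((h.memLp i x.1).integrable one_le_two) (integrable_const _), h.unbiased]
  simp

lemma integrable_sqDist_step_self (h : P.Assumptions μ L σ b wopt) {v : Variant} (hv : v.Valid)
    (γ τ : ℝ) (x : State d N) :
    Integrable (fun ξ => sqDist τ x (P.step v γ x ξ)) (P.noiseLaw v) := by
  have m1 := (modelUpdate_moment P.sampleLaw hv.qUp_pos hv.qDwn_pos γ (x.1 - x.1)
    (fun i => h.memLp_message i x) x.2).1
  have m2 := fun i => (memoryUpdate_moment P.sampleLaw v.qDwn hv.qUp_pos v.α i
    (h.memLp_message i x) 0).1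
  refine (m1.add ((integrable_finsetSum Finset.univ fun i _ => m2 i).const_mul (τ ^ 2))).congr
    (ae_of_all _ fun ξ => ?_)
  simp only [Pi.add_apply, sqDist]
  rw [norm_sub_rev x.1, step_fst_sub_const]
  congr 2
  refine Finset.sum_congr rfl fun i _ => ?_
  rw [norm_sub_rev]
  simp [step, compressedDiff]

/-- The iteration of the algorithm is contractive for every admissible step size. -/
lemma exists_isContractive (h : P.Assumptions μ L σ b wopt) (hN : 0 < N) (hμ : 0 < μ)
    (hL : 0 < L) {v : Variant} (hv : v.Valid) {γ : ℝ} (hγ : v.StepSize N μ L γ) :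
    ∃ τ : ℝ, 0 < τ ∧ ∃ K K' : ℝ≥0∞, IsContractive (P.noiseLaw v) (P.step v γ)
      (fun p => stateSqDist τ p.1 p.2) {x | Allowed v x} (ENNReal.ofReal (1 - γ * μ)) K K' := by
  obtain ⟨τ, hτ, hcon⟩ : ∃ τ : ℝ, 0 < τ ∧ ∀ x y : State d N, Allowed v x → Allowed v y →
      ∫ ξ, sqDist τ (P.step v γ x ξ) (P.step v γ y ξ) ∂(P.noiseLaw v)
        ≤ (1 - γ * μ) * sqDist τ x y := by
    by_cases hα : v.α = 0
    · exact ⟨1, one_pos, fun x y hx hy => h.contraction_noMemory hN hL hv hα hγ (hx hα) (hy hα)⟩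
    · obtain ⟨τ, hτ, hc⟩ := h.exists_contraction_memory hN hL hv hα hγ
      exact ⟨τ, hτ, fun x y _ _ => hc x y⟩
  have hsq : ∀ x y : State d N, stateSqDist τ x y = ENNReal.ofReal (sqDist τ x y) :=
    fun x y => rfl
  have hen : ∀ x y : State d N, ‖x - y‖ₑ ^ 2 = ENNReal.ofReal (‖x - y‖ ^ 2) := fun x y => by
    rw [ENNReal.ofReal_pow (norm_nonneg _), ofReal_norm]
  refine ⟨τ, hτ, ENNReal.ofReal (1 + (τ ^ 2)⁻¹), ENNReal.ofReal (1 + τ ^ 2 * N), ?_⟩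
  exact
  { measurable_map := P.measurable_step v γ
    measurable_cost := (continuous_sqDist τ).measurable.ennreal_ofReal
    isClosed := by
      by_cases hα : v.α = 0
      · simp only [Allowed, hα, true_imp_iff, Set.ofPred_forall]
        exact isClosed_iInter fun i => isClosed_eq (by fun_prop) continuous_const
      · simp [Allowed, hα]
    mapsTo := fun x hx ξ hα i => by simp [step, hα, hx hα i]
    contract := fun x hx y hy => by
      simp only [hsq]
      rw [← ofReal_integral_eq_lintegral_ofReal (integral_sqDist_step h hv γ τ x y).1
        (ae_of_all _ fun ξ => sqDist_nonneg _ _ _), ← ENNReal.ofReal_mul' (sqDist_nonneg _ _ _)]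
      exact ENNReal.ofReal_le_ofReal (hcon x y hx hy)
    rate_lt_one := by
      rw [ENNReal.ofReal_lt_one]
      have := mul_pos hγ.pos hμ
      linarith
    lower_ne_top := ENNReal.ofReal_ne_top
    upper_ne_top := ENNReal.ofReal_ne_top
    sq_le_cost := fun x y => by
      simp only [hsq]
      rw [hen, ← ENNReal.ofReal_mul (by positivity)]
      exact ENNReal.ofReal_le_ofReal (norm_sq_le_sqDist hτ x y)
    cost_le_sq := fun x y => by
      simp only [hsq]
      rw [hen, ← ENNReal.ofReal_mul (by positivity)]
      exact ENNReal.ofReal_le_ofReal (sqDist_le_norm_sq τ x y)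
    start := fun x _ => by
      simp only [hsq]
      rw [← ofReal_integral_eq_lintegral_ofReal (h.integrable_sqDist_step_self hv γ τ x)
        (ae_of_all _ fun ξ => sqDist_nonneg _ _ _)]
      exact ENNReal.ofReal_ne_top }

/-- Limit distribution, linear rate, and convergence of the second moment. -/
theorem exists_limit_distribution (h : P.Assumptions μ L σ b wopt) (hN : 0 < N) (hμ : 0 < μ)
    (hL : 0 < L) {v : Variant} (hv : v.Valid) {γ : ℝ} (hγ : v.StepSize N μ L γ) :
    ∃ ρ : Measure (State d N), P.IsStationary v γ ρ ∧
      (∀ ρ' : Measure (State d N), P.IsStationary v γ ρ' → ρ' = ρ) ∧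
      (∃ τ : ℝ, 0 < τ ∧ ∀ x₀ : State d N, Allowed v x₀ →
        (∫⁻ x, stateSqDist τ x₀ x ∂ρ) < ∞ ∧
        ∀ k : ℕ,
          stateW2Sq τ ((P.kernel v γ ^ k) x₀) ρ ≤
            ENNReal.ofReal ((1 - γ * μ) ^ k) * ∫⁻ x, stateSqDist τ x₀ x ∂ρ ∧
          w2Sq (P.modelLaw v γ x₀ k) (ρ.map Prod.fst) ≤
            ENNReal.ofReal ((1 - γ * μ) ^ k) * ∫⁻ x, stateSqDist τ x₀ x ∂ρ) ∧
      Integrable (fun w => ‖w - wopt‖ ^ 2) (ρ.map Prod.fst) ∧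
      ∀ x₀ : State d N, Allowed v x₀ →
        (∀ k : ℕ, Integrable (fun w => ‖w - wopt‖ ^ 2) (P.modelLaw v γ x₀ k)) ∧
        Tendsto (fun k : ℕ => ∫ w, ‖w - wopt‖ ^ 2 ∂(P.modelLaw v γ x₀ k)) atTop
          (𝓝 (∫ w, ‖w - wopt‖ ^ 2 ∂(ρ.map Prod.fst))) := by
  obtain ⟨τ, hτ, K, K', hC⟩ := h.exists_isContractive hN hμ hL hv hγ
  have hker : P.kernel v γ = iterKernel (P.noiseLaw v) (P.step v γ) hC.measurable_map := rfl
  obtain ⟨ρ, hρ, hinv, hA, hρ2⟩ := hC.exists_invariant ⟨0, fun _ _ => rfl⟩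
  have hl : LipschitzWith 1 fun x : State d N => x.1 - wopt := by
    refine LipschitzWith.of_dist_le_mul fun x y => ?_
    rw [dist_sub_right, NNReal.coe_one, one_mul, dist_eq_norm, dist_eq_norm]
    exact norm_fst_le (x - y)
  have hlρ : MemLp (fun x : State d N => x.1 - wopt) 2 ρ := hρ2.fst.sub (memLp_const _)
  have hm : ∀ ν : Measure (Param d), AEStronglyMeasurable (fun w => ‖w - wopt‖ ^ 2) ν :=
    fun ν => Continuous.aestronglyMeasurable (by fun_prop)
  refine ⟨ρ, ⟨hρ, hinv, hA⟩, ?_, ⟨τ, hτ, fun x₀ hx₀ => ⟨?_, fun k => ?_⟩⟩, ?_, fun x₀ hx₀ => ?_⟩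
  · intro ρ' hρ'
    have := hρ'.prob
    exact hC.invariant_unique hρ'.invariant hinv hρ'.allowed hA
  · exact hC.lintegral_cost_lt_top hρ2 x₀
  · obtain ⟨ξ, hξ, hle⟩ := hC.exists_coupling_le hinv hA hx₀ k
    -- When `d = 0` the number `1 - γμ` may be negative; its truncation to `0` only strengthens the
    -- bound.
    have hpow : ENNReal.ofReal (1 - γ * μ) ^ k ≤ ENNReal.ofReal ((1 - γ * μ) ^ k) := by
      rcases le_total 0 (1 - γ * μ) with h0 | h0
      · rw [ENNReal.ofReal_pow h0]
      · rcases k with _ | k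
        · simp
        · simp [ENNReal.ofReal_of_nonpos h0]
    have hle' : ∫⁻ p, stateSqDist τ p.1 p.2 ∂ξ
        ≤ ENNReal.ofReal ((1 - γ * μ) ^ k) * ∫⁻ x, stateSqDist τ x₀ x ∂ρ :=
      hle.trans (by gcongr)
    refine ⟨(iInf₂_le ξ hξ).trans hle', ?_⟩
    have hmap : Measurable (Prod.map Prod.fst Prod.fst : State d N × State d N → _) :=
      measurable_fst.prodMap measurable_fst
    refine (iInf₂_le (ξ.map (Prod.map Prod.fst Prod.fst)) ⟨?_, ?_⟩).trans
      (le_trans ?_ hle')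
    · rw [lintegral_map (by fun_prop) hmap]
      refine lintegral_mono fun p => ENNReal.ofReal_le_ofReal ?_
      have : 0 ≤ τ ^ 2 * ∑ i, ‖p.1.2 i - p.2.2 i‖ ^ 2 := by positivity
      simp only [Prod.map_fst, Prod.map_snd]
      linarith
    · rw [Measure.map_map measurable_fst hmap, modelLaw, hker, ← hξ.1,
        Measure.map_map measurable_fst measurable_fst]
      rfl
    · rw [Measure.map_map measurable_snd hmap, ← hξ.2,
        Measure.map_map measurable_fst measurable_snd]
      rfl
  · rw [integrable_map_measure (hm _) measurable_fst.aemeasurable]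
    exact hlρ.integrable_norm_pow two_ne_zero
  · obtain ⟨h1, h2⟩ := hC.tendsto_integral_sq hinv hA hρ2 hx₀ hl hlρ
    have e : ∀ ν : Measure (State d N), ∫ w, ‖w - wopt‖ ^ 2 ∂(ν.map Prod.fst)
        = ∫ x, ‖x.1 - wopt‖ ^ 2 ∂ν := fun ν =>
      integral_map measurable_fst.aemeasurable (hm _)
    refine ⟨fun k => ?_, ?_⟩
    · rw [modelLaw, integrable_map_measure (hm _) measurable_fst.aemeasurable]
      exact h1 k
    · simp only [modelLaw, e]
      exact h2

end Assumptions
end Problem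
-- Small step sizes and the lower bound at stationarity
/-- Small step sizes are admissible. -/
lemma Variant.Valid.exists_stepSize {v : Variant} (hv : v.Valid) {N : ℕ} (hN : 0 < N) {μ L : ℝ}
    (hL : 0 < L) : ∃ γ₀ : ℝ, 0 < γ₀ ∧ ∀ γ : ℝ, 0 < γ → γ ≤ γ₀ → v.StepSize N μ L γ := by
  have hN' : (1 : ℝ) ≤ N := by exact_mod_cast hN
  have hω : 1 ≤ v.ωUp + 1 := by
    simpa [Variant.ωUp] using (one_le_inv₀ hv.qUp_pos).2 v.qUp.2.2
  have hωd : 1 ≤ v.ωDwn + 1 := by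
    simpa [Variant.ωDwn] using (one_le_inv₀ hv.qDwn_pos).2 v.qDwn.2.2
  by_cases hα : v.α = 0
  · refine ⟨N / (L * (v.ωDwn + 1) * (N + 2 * (v.ωUp + 1))), by positivity, fun γ h0 h1 => ?_⟩
    exact ⟨h0, fun _ => h1, fun h => absurd hα h⟩
  · obtain ⟨ha1, ha2⟩ := hv.α_range.resolve_left hα
    have hαpos : 0 < v.α := lt_of_lt_of_le (by positivity) ha1
    have ha3 : v.α * (2 * (v.ωUp + 1)) < 3 := (lt_div_iff₀ (by positivity)).1 ha2
    have hD : 0 < (N : ℝ) + 4 * (v.ωUp + 1) - 2 := by linarith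
    -- At `γ = 0` the three memory conditions hold strictly, the last two by `α < 3 / (2(ω_up +
    -- 1))`, so continuity gives a neighbourhood.
    have e1 : ∀ᶠ γ : ℝ in 𝓝 0,
        γ < N / ((v.ωDwn + 1) * (N + 4 * (v.ωUp + 1) - 2) * L) :=
      gt_mem_nhds (by positivity)
    have e2 : ∀ᶠ γ : ℝ in 𝓝 0,
        v.α < (3 * N - γ * L * (v.ωDwn + 1) * (3 * N + 8 * (v.ωUp + 1) - 2)) /
          (2 * (v.ωUp + 1) * (N - γ * L * (v.ωDwn + 1) * (N + 2))) := by
      have hc : ContinuousAt (fun γ : ℝ =>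
          (3 * N - γ * L * (v.ωDwn + 1) * (3 * N + 8 * (v.ωUp + 1) - 2)) /
          (2 * (v.ωUp + 1) * (N - γ * L * (v.ωDwn + 1) * (N + 2)))) 0 := by
        refine ContinuousAt.div (by fun_prop) (by fun_prop) ?_
        simp only [zero_mul, sub_zero]
        positivity
      refine hc.eventually_const_lt ?_
      simp only [zero_mul, sub_zero]
      rw [lt_div_iff₀ (by positivity)]
      nlinarith
    have e3 : ∀ᶠ γ : ℝ in 𝓝 0, 2 * (γ * μ) < v.α * (3 - 2 * v.α * (v.ωUp + 1)) := by
      have hc : ContinuousAt (fun γ : ℝ => 2 * (γ * μ)) 0 := by fun_prop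
      refine hc.eventually_lt_const ?_
      simp only [zero_mul, mul_zero]
      exact mul_pos hαpos (by linarith)
    obtain ⟨ε, hε, hball⟩ := Metric.eventually_nhds_iff.1 (e1.and (e2.and e3))
    refine ⟨ε / 2, by positivity, fun γ h0 h1 => ?_⟩
    have hd : dist γ 0 < ε := by
      rw [Real.dist_eq, sub_zero, abs_of_pos h0]; linarith
    obtain ⟨h1, h2, h3⟩ := hball hd
    exact ⟨h0, fun h => absurd h hα, fun _ => ⟨h1, h2, h3.le⟩⟩

namespace Problem

variable {d N b : ℕ} {Z : Type*} [MeasurableSpace Z] {P : Problem d N Z} {μ L σ : ℝ}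
  {wopt : Param d}

namespace Assumptions

lemma norm_sub_sq_le_two_mul {H : Type*} [NormedAddCommGroup H] (x y : H) :
    ‖x - y‖ ^ 2 ≤ 2 * ‖x‖ ^ 2 + 2 * ‖y‖ ^ 2 := by
  have h1 := norm_sub_le x y
  have h2 : ‖x - y‖ ^ 2 ≤ (‖x‖ + ‖y‖) ^ 2 := by gcongr
  nlinarith [sq_nonneg (‖x‖ - ‖y‖)]

lemma memLp_noise (h : P.Assumptions μ L σ b wopt) (i : Fin N) (w : Param d) :
    MemLp (fun z => P.g i w z - gradient (P.F i) w) 2 (P.sampleLaw i) :=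
  (h.memLp i w).sub (memLp_const _)

/-- The noise of the stochastic gradient at the optimum is controlled by the noise at `w`. -/
lemma noise_wopt_le (h : P.Assumptions μ L σ b wopt) (i : Fin N) (w : Param d) :
    ∫ z, ‖P.g i wopt z - gradient (P.F i) wopt‖ ^ 2 ∂(P.sampleLaw i)
      ≤ 2 * ∫ z, ‖P.g i w z - gradient (P.F i) w‖ ^ 2 ∂(P.sampleLaw i)
        + 2 * ∫ z, ‖P.g i w z - P.g i wopt z‖ ^ 2 ∂(P.sampleLaw i) := by
  set G := gradient (P.F i) w - gradient (P.F i) wopt with hG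
  have hD : MemLp (fun z => P.g i w z - P.g i wopt z - G) 2 (P.sampleLaw i) :=
    (h.memLp_sub i w wopt).sub (memLp_const _)
  -- Centring does not increase the second moment.
  have e1 : ∫ z, ‖P.g i w z - P.g i wopt z - G‖ ^ 2 ∂(P.sampleLaw i)
      ≤ ∫ z, ‖P.g i w z - P.g i wopt z‖ ^ 2 ∂(P.sampleLaw i) := by
    rw [integral_norm_sub_sq _ (h.memLp_sub i w wopt), h.integral_sub_eq,
      real_inner_self_eq_norm_sq]
    have : 0 ≤ ‖gradient (P.F i) w - gradient (P.F i) wopt‖ ^ 2 := by positivity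
    linarith
  have i1 := ((h.memLp_noise i w).integrable_norm_pow two_ne_zero).const_mul 2
  have i2 := (hD.integrable_norm_pow two_ne_zero).const_mul 2
  calc _ ≤ ∫ z, (2 * ‖P.g i w z - gradient (P.F i) w‖ ^ 2
        + 2 * ‖P.g i w z - P.g i wopt z - G‖ ^ 2) ∂(P.sampleLaw i) := by
        refine integral_mono ((h.memLp_noise i wopt).integrable_norm_pow two_ne_zero)
          (i1.add i2) fun z => ?_
        have e : P.g i wopt z - gradient (P.F i) wopt
            = (P.g i w z - gradient (P.F i) w) - (P.g i w z - P.g i wopt z - G) := by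
          rw [hG]; abel
        simp only [e]
        exact norm_sub_sq_le_two_mul _ _
    _ = 2 * ∫ z, ‖P.g i w z - gradient (P.F i) w‖ ^ 2 ∂(P.sampleLaw i)
        + 2 * ∫ z, ‖P.g i w z - P.g i wopt z - G‖ ^ 2 ∂(P.sampleLaw i) := by
        have i1' : Integrable (fun z => 2 * ‖P.g i w z - gradient (P.F i) w‖ ^ 2)
          (P.sampleLaw i) := i1
        have i2' : Integrable (fun z => 2 * ‖P.g i w z - P.g i wopt z - G‖ ^ 2)
          (P.sampleLaw i) := i2
        rw [integral_add i1' i2', integral_const_mul, integral_const_mul]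
    _ ≤ _ := by gcongr

/-- Mean squared distance to the optimum after one iteration: bias-variance decomposition. -/
lemma integral_step_sub_wopt (h : P.Assumptions μ L σ b wopt) {v : Variant} (hv : v.Valid)
    (γ : ℝ) (x : State d N) :
    ∫ ξ, ‖(P.step v γ x ξ).1 - wopt‖ ^ 2 ∂(P.noiseLaw v)
      = ‖x.1 - wopt‖ ^ 2 - 2 * γ * inner ℝ ((N : ℝ)⁻¹ • ∑ i, (gradient (P.F i) x.1
            - gradient (P.F i) wopt)) (x.1 - wopt)
        + γ ^ 2 * (v.qDwn : ℝ)⁻¹ * (‖(N : ℝ)⁻¹ • ∑ i, (gradient (P.F i) x.1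
            - gradient (P.F i) wopt)‖ ^ 2
          + ((N : ℝ)⁻¹) ^ 2 * ∑ i, ((v.qUp : ℝ)⁻¹ *
              ∫ z, ‖P.g i x.1 z - gradient (P.F i) x.1‖ ^ 2 ∂(P.sampleLaw i)
            + v.ωUp * ‖gradient (P.F i) x.1 - x.2 i‖ ^ 2)) := by
  have hm := (modelUpdate_moment P.sampleLaw hv.qUp_pos hv.qDwn_pos γ (x.1 - wopt)
    (fun i => h.memLp_message i x) x.2).2
  simp_rw [step_fst_sub_const]
  refine hm.trans ?_
  simp_rw [h.integral_message, sub_add_cancel]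
  -- The averaged gradient vanishes at the optimum, although the individual ones need not.
  have e1 : (N : ℝ)⁻¹ • ∑ i, (gradient (P.F i) x.1 - gradient (P.F i) wopt)
      = (N : ℝ)⁻¹ • ∑ i, gradient (P.F i) x.1 := by
    rw [Finset.sum_sub_distrib, smul_sub, ← h.gradient_objective wopt,
      h.gradient_objective_wopt, sub_zero]
  rw [e1]
  congr 4
  refine Finset.sum_congr rfl fun i _ => ?_
  rw [integral_norm_sub_sq _ (h.memLp i x.1), integral_norm_sub_sq _ (h.memLp i x.1), h.unbiased,
    real_inner_self_eq_norm_sq, norm_sub_sq_real (gradient (P.F i) x.1) (x.2 i), Variant.ωUp]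
  ring

/-- Cocoercivity bounds the squared norm of the averaged gradient difference by `L` times the inner
product `X`. Young's inequality then gives `X ≤ X/2 + (L/2)‖w - u‖²`. -/
lemma inner_average_gradient_le (h : P.Assumptions μ L σ b wopt) (hN : 0 < N) (hL : 0 < L)
    (w u : Param d) :
    inner ℝ ((N : ℝ)⁻¹ • ∑ i, (gradient (P.F i) w - gradient (P.F i) u)) (w - u)
      ≤ L * ‖w - u‖ ^ 2 := by
  have h3 := h.norm_average_gradient_sub_sq_le hN w u
  set y := (N : ℝ)⁻¹ • ∑ i, (gradient (P.F i) w - gradient (P.F i) u)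
  have hc := real_inner_le_norm y (w - u)
  set X := inner ℝ y (w - u)
  have h4 : ‖y‖ * ‖w - u‖ ≤ (2 * L)⁻¹ * ‖y‖ ^ 2 + L / 2 * ‖w - u‖ ^ 2 := by
    have e : (2 * L)⁻¹ * ‖y‖ ^ 2 + L / 2 * ‖w - u‖ ^ 2 - ‖y‖ * ‖w - u‖
        = (2 * L)⁻¹ * (‖y‖ - L * ‖w - u‖) ^ 2 := by field_simp; ring
    have : 0 ≤ (2 * L)⁻¹ * (‖y‖ - L * ‖w - u‖) ^ 2 := by positivity
    linarith
  have h5 : (2 * L)⁻¹ * ‖y‖ ^ 2 ≤ (2 * L)⁻¹ * (L * X) := by gcongr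
  have h6 : (2 * L)⁻¹ * (L * X) = X / 2 := by field_simp
  linarith

/-- Lower bound on the mean squared distance to the optimum after one iteration. -/
lemma integral_step_sub_wopt_ge (h : P.Assumptions μ L σ b wopt) (hN : 0 < N) (hL : 0 < L)
    {v : Variant} (hv : v.Valid) {γ κ η : ℝ} (hγ : 0 < γ)
    (hγ' : γ * ((v.qDwn : ℝ)⁻¹ * (2 * (v.qUp : ℝ)⁻¹ * L)) ≤ N)
    (hκ : ∀ i, κ * (σ ^ 2 / b) ≤
      ∫ z, ‖P.g i wopt z - gradient (P.F i) wopt‖ ^ 2 ∂(P.sampleLaw i))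
    (hη : v.α = 0 → η = v.ωUp * P.heterogeneity wopt) (hη' : v.α ≠ 0 → η = 0)
    {x : State d N} (hx : Allowed v x) :
    (1 - 3 * (γ * L)) * ‖x.1 - wopt‖ ^ 2
      + γ ^ 2 * (v.qDwn : ℝ)⁻¹ * (N : ℝ)⁻¹ * (((v.qUp : ℝ)⁻¹ * (κ * (σ ^ 2 / b)) + η) / 2)
      ≤ ∫ ξ, ‖(P.step v γ x ξ).1 - wopt‖ ^ 2 ∂(P.noiseLaw v) := by
  rw [h.integral_step_sub_wopt hv]
  have hN' : (0 : ℝ) < N := by exact_mod_cast hN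
  have hX1 := h.inner_average_gradient_le hN hL x.1 wopt
  have hX2 := h.sum_cocoercive hN x.1 wopt
  have hX3 := h.norm_average_gradient_sub_sq_le hN x.1 wopt
  set X := inner ℝ ((N : ℝ)⁻¹ • ∑ i, (gradient (P.F i) x.1 - gradient (P.F i) wopt)) (x.1 - wopt)
  set M := ‖(N : ℝ)⁻¹ • ∑ i, (gradient (P.F i) x.1 - gradient (P.F i) wopt)‖ ^ 2
  set Q := (v.qUp : ℝ)⁻¹ with hQ
  set A := (v.qDwn : ℝ)⁻¹ with hA
  have hQ1 : 1 ≤ Q := (one_le_inv₀ hv.qUp_pos).2 v.qUp.2.2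
  have hA1 : 1 ≤ A := (one_le_inv₀ hv.qDwn_pos).2 v.qDwn.2.2
  have hω : v.ωUp = Q - 1 := rfl
  have hM0 : 0 ≤ M := by positivity
  have hXnn : 0 ≤ X := nonneg_of_mul_nonneg_right (hM0.trans hX3) hL
  have hLX : 0 ≤ L * (N * X) := by positivity
  set n := fun i => ∫ z, ‖P.g i x.1 z - gradient (P.F i) x.1‖ ^ 2 ∂(P.sampleLaw i)
  have hn : N * (κ * (σ ^ 2 / b)) ≤ 2 * ∑ i, n i + 2 * (L * (N * X)) := by
    calc N * (κ * (σ ^ 2 / b)) = ∑ _i : Fin N, κ * (σ ^ 2 / b) := by simp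
      _ ≤ ∑ i, (2 * n i + 2 * ∫ z, ‖P.g i x.1 z - P.g i wopt z‖ ^ 2 ∂(P.sampleLaw i)) :=
          Finset.sum_le_sum fun i _ => (hκ i).trans (h.noise_wopt_le i x.1)
      _ ≤ _ := by
          rw [Finset.sum_add_distrib, ← Finset.mul_sum, ← Finset.mul_sum]
          linarith
  -- Without memory the compressed vector has mean `∇F_i(w)`, whose size near the optimum is
  -- governed by the heterogeneity. With memory `h^i` may be close to `∇F_i(w)`, so nothing is
  -- claimed for this term and `η = 0`.
  have hG : N * η ≤ 2 * ∑ i, v.ωUp * ‖gradient (P.F i) x.1 - x.2 i‖ ^ 2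
      + 2 * (v.ωUp * (L * (N * X))) := by
    have hω0 : 0 ≤ v.ωUp := by rw [hω]; linarith
    by_cases hα : v.α = 0
    · rw [hη hα, heterogeneity]
      have hs : ∑ i, ‖gradient (P.F i) wopt‖ ^ 2
          ≤ 2 * ∑ i, ‖gradient (P.F i) x.1 - x.2 i‖ ^ 2 + 2 * (L * (N * X)) := by
        calc _ ≤ ∑ i, (2 * ‖gradient (P.F i) x.1 - x.2 i‖ ^ 2
              + 2 * ‖gradient (P.F i) x.1 - gradient (P.F i) wopt‖ ^ 2) := by
              refine Finset.sum_le_sum fun i _ => ?_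
              rw [hx hα i, sub_zero]
              have := norm_sub_sq_le_two_mul (gradient (P.F i) x.1)
                (gradient (P.F i) x.1 - gradient (P.F i) wopt)
              rwa [sub_sub_cancel] at this
          _ ≤ _ := by
              rw [Finset.sum_add_distrib, ← Finset.mul_sum, ← Finset.mul_sum]
              have := Finset.sum_le_sum (s := Finset.univ) fun i _ =>
                h.norm_gradient_sub_sq_le i x.1 wopt
              linarith
      rw [← Finset.mul_sum]
      calc N * (v.ωUp * ((N : ℝ)⁻¹ * ∑ i, ‖gradient (P.F i) wopt‖ ^ 2))
          = v.ωUp * ∑ i, ‖gradient (P.F i) wopt‖ ^ 2 := by field_simp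
        _ ≤ v.ωUp * (2 * ∑ i, ‖gradient (P.F i) x.1 - x.2 i‖ ^ 2 + 2 * (L * (N * X))) := by
            gcongr
        _ = _ := by ring
    · rw [hη' hα, mul_zero]
      exact add_nonneg (mul_nonneg zero_le_two (Finset.sum_nonneg fun i _ =>
        mul_nonneg hω0 (sq_nonneg _))) (mul_nonneg zero_le_two (mul_nonneg hω0 hLX))
  rw [Finset.sum_add_distrib, ← Finset.mul_sum]
  have hsum : N * ((Q * (κ * (σ ^ 2 / b)) + η) / 2) - 2 * Q * L * (N * X)
      ≤ Q * ∑ i, n i + ∑ i, v.ωUp * ‖gradient (P.F i) x.1 - x.2 i‖ ^ 2 := by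
    have h1 := mul_le_mul_of_nonneg_left hn (by linarith : 0 ≤ Q)
    have h2 : v.ωUp * (L * (N * X)) ≤ Q * (L * (N * X)) := by
      gcongr
      linarith
    linarith
  have hmul := mul_le_mul_of_nonneg_left hsum
    (by positivity : 0 ≤ γ ^ 2 * A * ((N : ℝ)⁻¹) ^ 2)
  have e1 : γ ^ 2 * A * ((N : ℝ)⁻¹) ^ 2 * (N * ((Q * (κ * (σ ^ 2 / b)) + η) / 2)
      - 2 * Q * L * (N * X)) = γ ^ 2 * A * (N : ℝ)⁻¹ * ((Q * (κ * (σ ^ 2 / b)) + η) / 2)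
        - γ * (N : ℝ)⁻¹ * (γ * (A * (2 * Q * L))) * X := by
    field_simp
  -- Replacing the noise at `w` by the noise at the optimum costs at most `γX` for small `γ`. With
  -- the descent term `2γX` the total is `3γX ≤ 3γL‖w - w_*‖²`, whence the constant `3`.
  have e2 : γ * (N : ℝ)⁻¹ * (γ * (A * (2 * Q * L))) * X ≤ γ * (N : ℝ)⁻¹ * N * X := by gcongr
  have e3 : γ * (N : ℝ)⁻¹ * N * X = γ * X := by field_simp
  have e4 : 0 ≤ γ ^ 2 * A * M := by positivity
  have e5 : γ * X ≤ γ * (L * ‖x.1 - wopt‖ ^ 2) := by gcongr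
  rw [mul_add (γ ^ 2 * A)]
  linarith

/-- Lower bound on the stationary second moment. -/
lemma stationary_moment_ge (h : P.Assumptions μ L σ b wopt) (hN : 0 < N) (hL : 0 < L)
    {v : Variant} (hv : v.Valid) {γ κ η : ℝ} (hγ : 0 < γ)
    (hγ' : γ * ((v.qDwn : ℝ)⁻¹ * (2 * (v.qUp : ℝ)⁻¹ * L)) ≤ N)
    (hκ : ∀ i, κ * (σ ^ 2 / b) ≤
      ∫ z, ‖P.g i wopt z - gradient (P.F i) wopt‖ ^ 2 ∂(P.sampleLaw i))
    (hη : v.α = 0 → η = v.ωUp * P.heterogeneity wopt) (hη' : v.α ≠ 0 → η = 0)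
    {ρ : Measure (State d N)} (hρ : P.IsStationary v γ ρ)
    (hint : Integrable (fun w => ‖w - wopt‖ ^ 2) (ρ.map Prod.fst)) :
    γ * (v.qDwn : ℝ)⁻¹ * ((v.qUp : ℝ)⁻¹ * (κ * (σ ^ 2 / b)) + η) / (6 * L * N)
      ≤ ∫ w, ‖w - wopt‖ ^ 2 ∂(ρ.map Prod.fst) := by
  have := hρ.prob
  have hN' : (0 : ℝ) < N := by exact_mod_cast hN
  have hm : ∀ ν : Measure (Param d), AEStronglyMeasurable (fun w => ‖w - wopt‖ ^ 2) ν :=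
    fun ν => Continuous.aestronglyMeasurable (by fun_prop)
  have hm' : ∀ ν : Measure (State d N), AEStronglyMeasurable (fun x => ‖x.1 - wopt‖ ^ 2) ν :=
    fun ν => Continuous.aestronglyMeasurable (by fun_prop)
  rw [integral_map measurable_fst.aemeasurable (hm _)]
  rw [integrable_map_measure (hm _) measurable_fst.aemeasurable] at hint
  have hint1 : Integrable (fun x : State d N => ‖x.1 - wopt‖ ^ 2) ρ := hint
  -- Stationarity as an identity of laws: a step from `ρ` with independent noise has law `ρ`.
  have hinv : (ρ.prod (P.noiseLaw v)).map (fun p => P.step v γ p.1 p.2) = ρ :=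
    (comp_iterKernel (hf := P.measurable_step v γ) ρ).symm.trans hρ.invariant.def
  have hst := P.measurable_step v γ
  have hint2 : Integrable (fun p : State d N × Noise d N Z => ‖(P.step v γ p.1 p.2).1 - wopt‖ ^ 2)
      (ρ.prod (P.noiseLaw v)) := by
    rw [← hinv, integrable_map_measure (hm' _) hst.aemeasurable] at hint1
    exact hint1
  have hV : ∫ x, ‖x.1 - wopt‖ ^ 2 ∂ρ
      = ∫ x, ∫ ξ, ‖(P.step v γ x ξ).1 - wopt‖ ^ 2 ∂(P.noiseLaw v) ∂ρ := by
    conv_lhs => rw [← hinv]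
    rw [integral_map hst.aemeasurable (hm' _), integral_prod _ hint2]
  set V := ∫ x, ‖x.1 - wopt‖ ^ 2 ∂ρ
  set κ' := γ ^ 2 * (v.qDwn : ℝ)⁻¹ * (N : ℝ)⁻¹ * (((v.qUp : ℝ)⁻¹ * (κ * (σ ^ 2 / b)) + η) / 2)
    with hκ'
  have hle : (1 - 3 * (γ * L)) * V + κ' ≤ V := by
    calc (1 - 3 * (γ * L)) * V + κ'
        = ∫ x, ((1 - 3 * (γ * L)) * ‖x.1 - wopt‖ ^ 2 + κ') ∂ρ := by
          rw [integral_add (hint1.const_mul _) (integrable_const _), integral_const_mul]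
          simp [V]
      _ ≤ ∫ x, ∫ ξ, ‖(P.step v γ x ξ).1 - wopt‖ ^ 2 ∂(P.noiseLaw v) ∂ρ := by
          refine integral_mono_ae ((hint1.const_mul _).add (integrable_const _))
            hint2.integral_prod_left ?_
          filter_upwards [hρ.allowed] with x hx
          exact h.integral_step_sub_wopt_ge hN hL hv hγ hγ' hκ hη hη' hx
      _ = V := hV.symm
  have e : γ * (v.qDwn : ℝ)⁻¹ * ((v.qUp : ℝ)⁻¹ * (κ * (σ ^ 2 / b)) + η) / (6 * L * N)
      = κ' / (3 * (γ * L)) := by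
    rw [hκ']; field_simp; ring
  rw [e, div_le_iff₀ (by positivity)]
  linarith

end Assumptions
end Problem

/-! ### The saturation constant and the conclusion -/

/-- The saturation constant is at most a multiple of the one-step noise level. -/
lemma Variant.Valid.satConst_le {v : Variant} (hv : v.Valid) {s B2 C κ Λ : ℝ} (hs : 0 ≤ s)
    (hB : 0 ≤ B2)
    (hC : v.α ≠ 0 → v.minC ≤ C ∧ v.α * C ≤ Λ * ((v.ωDwn + 1) * (v.ωUp + 1))) (hκ : 0 < κ) :
    min κ 1 * v.satConst s B2 C ≤ (2 + 4 * |Λ|) * ((v.qDwn : ℝ)⁻¹ *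
      ((v.qUp : ℝ)⁻¹ * (κ * s) + if v.α = 0 then v.ωUp * B2 else 0)) := by
  set Q := (v.qUp : ℝ)⁻¹ with hQ
  set A := (v.qDwn : ℝ)⁻¹ with hA
  have hω : v.ωUp = Q - 1 := rfl
  have hωd : v.ωDwn = A - 1 := rfl
  have hQ1 : 1 ≤ Q := (one_le_inv₀ hv.qUp_pos).2 v.qUp.2.2
  have hA1 : 1 ≤ A := (one_le_inv₀ hv.qDwn_pos).2 v.qDwn.2.2
  have hQ0 : 0 ≤ Q - 1 := by linarith
  have hm0 : 0 < min κ 1 := lt_min hκ one_pos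
  have hΛ : 0 ≤ |Λ| := abs_nonneg _
  rw [Variant.satConst]
  split_ifs with hα
  · rw [hω, hωd, sub_add_cancel, sub_add_cancel]
    have h1 : min κ 1 * (A * (Q * s + (Q - 1) * B2)) ≤ A * (Q * (κ * s) + (Q - 1) * B2) := by
      have e1 : min κ 1 * (Q * s) ≤ κ * (Q * s) := by gcongr; exact min_le_left _ _
      have e2 : min κ 1 * ((Q - 1) * B2) ≤ 1 * ((Q - 1) * B2) := by gcongr; exact min_le_right _ _
      calc _ = A * (min κ 1 * (Q * s) + min κ 1 * ((Q - 1) * B2)) := by ring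
        _ ≤ A * (κ * (Q * s) + 1 * ((Q - 1) * B2)) := by gcongr
        _ = _ := by ring
    have h2 : 0 ≤ A * (Q * (κ * s) + (Q - 1) * B2) := by positivity
    nlinarith
  · obtain ⟨hC1, hC2⟩ := hC hα
    obtain ⟨ha1, ha2⟩ := hv.α_range.resolve_left hα
    simp only [hω, hωd, sub_add_cancel, Variant.minC] at ha1 ha2 hC1 hC2 ⊢
    have hαpos : 0 < v.α := lt_of_lt_of_le (by positivity) ha1
    rw [div_le_iff₀ (by positivity)] at ha1
    rw [lt_div_iff₀ (by positivity)] at ha2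
    have hden : 0 < 3 - 2 * v.α * Q := by linarith
    have hC0 : 0 ≤ C := le_trans (by positivity) hC1
    have hαC : v.α * C ≤ |Λ| * (A * Q) := hC2.trans (by gcongr; exact le_abs_self _)
    have hαC0 : 0 ≤ v.α * C := by positivity
    -- Since `2αQ ≤ 3`, the terms in `C` are at most `4αC ≤ 4|Λ|AQ`, and the remaining one is at
    -- most `2AQ`.
    have hE : (2 * (Q - 1) + 1) * A + 4 * v.α ^ 2 * C * Q - 2 * v.α * C
        ≤ (2 + 4 * |Λ|) * (A * Q) := by
      have e1 : 4 * v.α ^ 2 * C * Q - 2 * v.α * C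
          = 2 * (v.α * C) * (v.α * (2 * Q) - 1) := by ring
      have e2 : 2 * (v.α * C) * (v.α * (2 * Q) - 1) ≤ 2 * (v.α * C) * 2 := by
        gcongr; linarith
      nlinarith
    calc _ ≤ min κ 1 * (s * ((2 + 4 * |Λ|) * (A * Q))) := by gcongr
      _ ≤ κ * (s * ((2 + 4 * |Λ|) * (A * Q))) := by gcongr; exact min_le_left _ _
      _ = _ := by ring

end Artemis

theorem theorem3 (μ L κ Λ : ℝ) (hμ : 0 < μ) (hL : 0 < L) (hκ : 0 < κ) :
    -- the constant of the lower bound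
    ∃ c : ℝ, 0 < c ∧
    ∀ (d N b : ℕ) (_ : 0 < N) (_ : 0 < b) (Z : Type*) [MeasurableSpace Z]
      (P : Artemis.Problem d N Z) (wopt : Artemis.Param d) (σ : ℝ)
      (_ : P.Assumptions μ L σ b wopt) (v : Artemis.Variant) (_ : v.Valid),
      -- limit distribution, linear rate, convergence of the second moment
      (∀ γ : ℝ, v.StepSize N μ L γ →
        ∃ ρ : Measure (Artemis.State d N),
          P.IsStationary v γ ρ ∧
          (∀ ρ' : Measure (Artemis.State d N), P.IsStationary v γ ρ' → ρ' = ρ) ∧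
          (∃ τ : ℝ, 0 < τ ∧
            ∀ x₀ : Artemis.State d N, Artemis.Problem.Allowed v x₀ →
              (∫⁻ x, Artemis.stateSqDist τ x₀ x ∂ρ) < ∞ ∧
              ∀ k : ℕ,
                Artemis.stateW2Sq τ ((P.kernel v γ ^ k) x₀) ρ ≤
                  ENNReal.ofReal ((1 - γ * μ) ^ k) * ∫⁻ x, Artemis.stateSqDist τ x₀ x ∂ρ ∧
                Artemis.w2Sq (P.modelLaw v γ x₀ k) (ρ.map Prod.fst) ≤
                  ENNReal.ofReal ((1 - γ * μ) ^ k) * ∫⁻ x, Artemis.stateSqDist τ x₀ x ∂ρ) ∧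
          Integrable (fun w => ‖w - wopt‖ ^ 2) (ρ.map Prod.fst) ∧
          ∀ x₀ : Artemis.State d N, Artemis.Problem.Allowed v x₀ →
            (∀ k : ℕ, Integrable (fun w => ‖w - wopt‖ ^ 2) (P.modelLaw v γ x₀ k)) ∧
            Tendsto (fun k : ℕ => ∫ w, ‖w - wopt‖ ^ 2 ∂(P.modelLaw v γ x₀ k)) atTop
              (𝓝 (∫ w, ‖w - wopt‖ ^ 2 ∂(ρ.map Prod.fst)))) ∧
      -- lower bound on the limit second moment as the step size tends to zero
      ((∀ i, κ * (σ ^ 2 / b) ≤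
          ∫ z, ‖P.g i wopt z - gradient (P.F i) wopt‖ ^ 2 ∂(P.sampleLaw i)) →
        ∀ C : ℝ,
          (v.α ≠ 0 → v.minC ≤ C ∧ v.α * C ≤ Λ * ((v.ωDwn + 1) * (v.ωUp + 1))) →
          ∃ γ₀ : ℝ, 0 < γ₀ ∧ ∀ γ : ℝ, 0 < γ → γ ≤ γ₀ →
            v.StepSize N μ L γ ∧
            ∀ ρ : Measure (Artemis.State d N), P.IsStationary v γ ρ →
              c * (γ * v.satConst (σ ^ 2 / b) (P.heterogeneity wopt) C / (μ * N)) ≤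
                ∫ w, ‖w - wopt‖ ^ 2 ∂(ρ.map Prod.fst)) := by
  -- The stationary bound has `6LN` in its denominator where the claim has `μN`, whence `μ / (6L)`;
  -- the rest is the loss in `satConst_le`. The minimum with `1` is needed because `κ` multiplies
  -- the noise but not the heterogeneity.
  refine ⟨μ * min κ 1 / (6 * L * (2 + 4 * |Λ|)), ?_, ?_⟩
  · have : 0 < min κ 1 := lt_min hκ one_pos
    positivity
  intro d N b hN hb Z _ P wopt σ h v hv
  refine ⟨fun γ hγ => h.exists_limit_distribution hN hμ hL hv hγ, fun hnoise C hC => ?_⟩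
  have hN' : (0 : ℝ) < N := by exact_mod_cast hN
  have hq := hv.qUp_pos
  have hq' := hv.qDwn_pos
  obtain ⟨γ₁, hγ₁, hstep⟩ := hv.exists_stepSize (μ := μ) hN hL
  have hγ₂ : 0 < N / ((v.qDwn : ℝ)⁻¹ * (2 * (v.qUp : ℝ)⁻¹ * L)) := by positivity
  refine ⟨min γ₁ (N / ((v.qDwn : ℝ)⁻¹ * (2 * (v.qUp : ℝ)⁻¹ * L))), lt_min hγ₁ hγ₂,
    fun γ h0 h1 => ?_⟩
  have hγ := hstep γ h0 (h1.trans (min_le_left _ _))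
  refine ⟨hγ, fun ρ hρ => ?_⟩
  -- By uniqueness any stationary law is the one constructed above, so its second moment is finite,
  -- as the balance argument requires.
  obtain ⟨ρ', -, huniq, -, hint, -⟩ := h.exists_limit_distribution hN hμ hL hv hγ
  rw [← huniq ρ hρ] at hint
  have hγ' : γ * ((v.qDwn : ℝ)⁻¹ * (2 * (v.qUp : ℝ)⁻¹ * L)) ≤ N :=
    (le_div_iff₀ (by positivity)).1 (h1.trans (min_le_right _ _))
  have hlow := h.stationary_moment_ge hN hL hv h0 hγ' hnoise
    (η := if v.α = 0 then v.ωUp * P.heterogeneity wopt else 0)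
    (fun hα => if_pos hα) (fun hα => if_neg hα) hρ hint
  refine le_trans ?_ hlow
  have hsat := hv.satConst_le (s := σ ^ 2 / b) (B2 := P.heterogeneity wopt) (by positivity)
    (by unfold Artemis.Problem.heterogeneity; positivity) hC hκ
  have hΛ : 0 < 2 + 4 * |Λ| := by positivity
  calc _ = γ / (6 * L * N * (2 + 4 * |Λ|)) * (min κ 1 *
        v.satConst (σ ^ 2 / b) (P.heterogeneity wopt) C) := by field_simp
    _ ≤ γ / (6 * L * N * (2 + 4 * |Λ|)) * ((2 + 4 * |Λ|) * ((v.qDwn : ℝ)⁻¹ * ((v.qUp : ℝ)⁻¹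
          * (κ * (σ ^ 2 / b)) + if v.α = 0 then v.ωUp * P.heterogeneity wopt else 0))) := by
        gcongr
    _ = _ := by field_simp
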